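/- **Setting.** Let $\mathcal B$ be a controllable linear time-invariant behavior (one with a kernel representation) with manifest variable $w=(y,u,d)$, $d$ of dimension at least one, where $(u,d)$ is a free input and $y$ a nonanticipating output. Let $L\ge \mathrm{lag}(\mathcal B)$, and let $\mathcal F$ have full column rank and column space equal to the $(L+1)$-step behavior $\mathcal B_{L+1}$. Each window of a trajectory is then $(w_{k-L},\dots,w_k)=\mathcal F g_k$ for a unique $g_k\in\mathbb R^{\mathsf g}$. Let $\Pi_y\mathcal F,\Pi_u\mathcal F,\Pi_f\mathcal F$, $\mathcal F_{dk}$ be the rows of $\mathcal F$ giving $y_k,u_k,w_k,d_k$, and $\mathcal F_{wp}$, $\Pi_p\mathcal F$ the rows giving $(w_{k-L},\dots,w_{k-1})$ and $(w_{k-L+1},\dots,w_k)$. With $A=\begin{bmatrix}\mathcal F_{wp}\\ \mathcal F_{dk}\end{bmatrix}$ and its Moore–Penrose inverse $A^\dagger$, put $\mathcal F_p=A^\dagger\begin{bmatrix}\Pi_p\mathcal F\\0\end{bmatrix}$, $\mathcal F_f=A^\dagger\begin{bmatrix}0\\I\end{bmatrix}$, and let $\mathcal F_z$ have orthonormal columns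 (as many as $u$ has components) spanning the column space of $I-A^\dagger A$. Put $\mathcal E_u=\mathcal F_z(\Pi_u\mathcal F\mathcal F_z)^{-1}$, $\mathcal E_p=(I-\mathcal E_u\Pi_u\mathcal F)\mathcal F_p$, $\mathcal E_f=(I-\mathcal E_u\Pi_u\mathcal F)\mathcal F_f$. **Uncertainty.** At times $k\ge1$, $d_k=m_k+\Delta d_k$ and $u_k=\bar u_k+\Delta u_k$, and $w_k^m=w_k+n_k$ is measured. Here $m_k=\mathbb E[d_k]$ is an arbitrary deterministic sequence of (finite) vectors; $\Delta d$ and $\Delta u$ are i.i.d. and $n$ is white, with zero means and positive definite covariances $\mathcal S_d,\mathcal S_u,\mathcal S_n$; the three are pairwise independent. **Filter and controller.** The initial parameterizer $g_0$ and its estimate $\hat g_{0|0}$ are square integrable and independent of each of the processes $(\Delta d_k)_{k\ge1}$, $(\Delta u_k)_{k\ge1}$, $(n_k)_{k\ge1}$; the error $g_0-\hat g_{0|0}$ has mean zero, covariance $\mathcal P_{0|0}$, and is uncorrelated with $\hat g_{0|0}$. For $k\ge1$ put $$\mathcal P_{k|k-1}=\mathcal E_p\mathcal P_{k-1|k-1}\mathcal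 E_p^\top+\mathcal E_f\mathcal S_d\mathcal E_f^\top+\mathcal E_u\mathcal S_u\mathcal E_u^\top,$$ $$\mathcal K_k=\mathcal P_{k|k-1}(\Pi_f\mathcal F)^\top\big(\Pi_f\mathcal F\,\mathcal P_{k|k-1}(\Pi_f\mathcal F)^\top+\mathcal S_n\big)^{-1},\qquad \mathcal P_{k|k}=(I-\mathcal K_k\Pi_f\mathcal F)\mathcal P_{k|k-1}.$$ Let $\mathcal P\ge0$ solve the algebraic Riccati equation $\mathcal P=\mathcal E_p\mathcal P\mathcal E_p^\top-\mathcal N+\mathcal Q$, where $\mathcal Q=\mathcal E_f\mathcal S_d\mathcal E_f^\top+\mathcal E_u\mathcal S_u\mathcal E_u^\top$, $\mathcal A=\Pi_f\mathcal F\mathcal E_p$, $\mathcal T=\Pi_f\mathcal F\mathcal Q$, $\mathcal R=\Pi_f\mathcal F\mathcal Q(\Pi_f\mathcal F)^\top+\mathcal S_n$, and $\mathcal N=(\mathcal A\mathcal P\mathcal E_p^\top+\mathcal T)^\top(\mathcal A\mathcal P\mathcal A^\top+\mathcal R)^{-1}(\mathcal A\mathcal P\mathcal E_p^\top+\mathcal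 T)$. **Theorem.** Let $\gamma_1,\gamma_2\ge0$ and suppose that there are symmetric $W,X\in\mathbb R^{\mathsf g\times\mathsf g}$ and matrices $Y_g,K_d$ with $$W>0,\qquad \gamma_2^2\,\mathrm{tr}(\mathcal S_d)-\mathrm{tr}(X)\ge0,\qquad \begin{bmatrix}X&*&*\\ \mathcal N^{1/2}&W&*\\ \Pi_y\mathcal F\mathcal P^{1/2}&0&I\end{bmatrix}\ge0,$$ $$\begin{bmatrix}W&*&*&*\\0&\gamma_1^2I&*&*\\ \Pi_y\mathcal FW&0&I&*\\ \mathcal F_pW+\mathcal F_zY_g&\mathcal F_f+\mathcal F_zK_d&0&W\end{bmatrix}\ge0.$$ Then the closed loop given, for $k\ge1$, by $$\hat g_{k|k-1}=(\mathcal F_p+\mathcal F_zY_gW^{-1})\hat g_{k-1|k-1}+(\mathcal F_f+\mathcal F_zK_d)\,\mathbb E[d_k],\qquad \bar u_k=\Pi_u\mathcal F\hat g_{k|k-1},$$ $$\hat g_{k|k}=\hat g_{k|k-1}+\mathcal K_k\,(w_k^m-\Pi_f\mathcal F\hat g_{k|k-1})$$ is feasible (for all such uncertainties and initial data there are processes satisfying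 these equations whose sample paths $w$ lie in $\mathcal B$), and every such closed loop has the following property. If the limit $$\rho=\lim_{T\to\infty}\frac{\frac1T\sum_{k=1}^T\|\mathbb E[d_k]\|^2}{\mathrm{tr}(\mathcal S_d)+\frac1T\sum_{k=1}^T\|\mathbb E[d_k]\|^2}$$ exists, then, with $\Gamma_T=\big(\sum_{k=1}^T\|y_k\|^2\big)^{1/2}\big/\big(\sum_{k=1}^T\|d_k\|^2\big)^{1/2}$, for every $\gamma>0$ with $\gamma\ge\sqrt{\rho\gamma_1^2+(1-\rho)\gamma_2^2}$, $$\mathbb P\Big\{\liminf_{T\to\infty}\mathbb P\{\Gamma_T\le\gamma\}\ \ge\ 1-\frac{\rho\gamma_1^2+(1-\rho)\gamma_2^2}{\gamma^2}\Big\}=1 .$$ -/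

import Mathlib

open MeasureTheory ProbabilityTheory Filter Topology Matrix

/-! ### Linear algebra -/

/-- Moore-Penrose inverse of a real matrix, `(Aᵀ A)† Aᵀ`, where the symmetric matrix `Aᵀ A` is
pseudo-inverted on its spectrum (recall `0⁻¹ = 0`); see `pinv_penrose`. -/
noncomputable def pinv {m n : Type*} [Fintype m] [Fintype n] [DecidableEq n]
    (A : Matrix m n ℝ) : Matrix n m ℝ :=
  cfc (fun x : ℝ => x⁻¹) (Aᵀ * A) * Aᵀ

/-- The four Penrose equations, which characterise the Moore-Penrose inverse. -/
theorem pinv_penrose {m n : Type*} [Fintype m] [Fintype n] [DecidableEq n]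
    (A : Matrix m n ℝ) :
    A * pinv A * A = A ∧ pinv A * A * pinv A = pinv A ∧
      (A * pinv A)ᵀ = A * pinv A ∧ (pinv A * A)ᵀ = pinv A * A := by
  have hH : IsSelfAdjoint (Aᵀ * A) := by
    rw [isSelfAdjoint_iff, star_eq_conjTranspose, conjTranspose_eq_transpose_of_trivial]
    simp
  have hc : ∀ f : ℝ → ℝ, ContinuousOn f (spectrum ℝ (Aᵀ * A)) := fun f =>
    (Matrix.finite_real_spectrum).continuousOn f
  set H := Aᵀ * A with hHdef
  set C := cfc (fun x : ℝ => x⁻¹) H with hC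
  have hHid : cfc (fun x : ℝ => x) H = H := cfc_id' ℝ H
  have hCT : Cᵀ = C := by
    have h : IsSelfAdjoint C := cfc_predicate _ _
    rwa [isSelfAdjoint_iff, star_eq_conjTranspose, conjTranspose_eq_transpose_of_trivial] at h
  have hHT : Hᵀ = H := by
    rwa [isSelfAdjoint_iff, star_eq_conjTranspose, conjTranspose_eq_transpose_of_trivial] at hH
  have hcomm : C * H = H * C := by
    have h := cfc_commute_cfc (fun x : ℝ => x⁻¹) (fun x : ℝ => x) H
    rw [hHid] at h
    exact h
  have hHC : H * C = cfc (fun x : ℝ => x * x⁻¹) H := by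
    rw [cfc_mul _ _ H (hc _) (hc _), hHid]
  have hHCH : H * C * H = H := by
    have h := cfc_mul (fun x : ℝ => x * x⁻¹) (fun x : ℝ => x) H (hc _) (hc _)
    rw [hHid, ← hHC] at h
    rw [← h]
    simp only [mul_inv_mul_cancel]
    exact hHid
  have hCHC : C * H * C = C := by
    have h := cfc_mul (fun x : ℝ => x⁻¹) (fun x : ℝ => x * x⁻¹) H (hc _) (hc _)
    rw [← hHC, ← hC] at h
    rw [Matrix.mul_assoc, ← h, hC]
    congr 1
    funext x
    by_cases hx : x = 0
    · simp [hx]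
    · field_simp
  have hz : A * C * H - A = 0 := by
    have h0 : (A * C * H - A)ᵀ * (A * C * H - A) = 0 := by
      have e1 : (A * C * H - A)ᵀ = H * C * Aᵀ - Aᵀ := by
        simp [Matrix.transpose_mul, hCT, hHT, Matrix.mul_assoc]
      have e2 : (A * C * H - A)ᵀ * A = 0 := by
        rw [e1, Matrix.sub_mul, Matrix.mul_assoc, ← hHdef, hHCH, sub_self]
      have e3 : (A * C * H - A)ᵀ * (A * C * H) = (A * C * H - A)ᵀ * A * (C * H) := by
        rw [Matrix.mul_assoc _ A, Matrix.mul_assoc A C H]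
      rw [Matrix.mul_sub, e3, e2, Matrix.zero_mul, sub_self]
    have := Matrix.conjTranspose_mul_self_eq_zero (A := A * C * H - A)
    rw [conjTranspose_eq_transpose_of_trivial] at this
    exact this.1 h0
  have hACH : A * C * H = A := sub_eq_zero.1 hz
  refine ⟨?_, ?_, ?_, ?_⟩
  · show A * (C * Aᵀ) * A = A
    rw [← Matrix.mul_assoc, Matrix.mul_assoc (A * C)]; exact hACH
  · show C * Aᵀ * A * (C * Aᵀ) = C * Aᵀ
    rw [Matrix.mul_assoc C Aᵀ A, ← Matrix.mul_assoc, ← hHdef, hCHC]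
  · show (A * (C * Aᵀ))ᵀ = A * (C * Aᵀ)
    simp [Matrix.transpose_mul, hCT, Matrix.mul_assoc]
  · show (C * Aᵀ * A)ᵀ = C * Aᵀ * A
    rw [Matrix.mul_assoc, ← hHdef, Matrix.transpose_mul, hCT, hHT, hcomm]

/-- Square root of a symmetric positive semidefinite real matrix. -/
noncomputable def msqrt {n : Type*} [Fintype n] [DecidableEq n] (A : Matrix n n ℝ) :
    Matrix n n ℝ :=
  cfc Real.sqrt A

/-! ### Behaviors

The manifest variable `w = (y, u, d)` takes values in `Y ⊕ U ⊕ D → ℝ`; a behavior is a set of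
sequences `ℕ → (Y ⊕ U ⊕ D → ℝ)`. -/

/-- `B` is the solution set of a linear difference equation
`R₀ w_t + R₁ w_{t+1} + ⋯ + R_ℓ w_{t+ℓ} = 0`. -/
def HasKernelRep {V : Type*} [Fintype V] (B : Set (ℕ → V → ℝ)) (l : ℕ) : Prop :=
  ∃ (q : ℕ) (R : Fin (l + 1) → Matrix (Fin q) V ℝ),
    B = {w | ∀ t : ℕ, ∑ i : Fin (l + 1), R i *ᵥ w (t + i) = 0}

/-- Linear time-invariant (complete) behaviors are those with a kernel representation. -/
def IsLTI {V : Type*} [Fintype V] (B : Set (ℕ → V → ℝ)) : Prop :=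
  ∃ l, HasKernelRep B l

/-- The lag: the smallest order of a kernel representation. -/
noncomputable def lag {V : Type*} [Fintype V] (B : Set (ℕ → V → ℝ)) : ℕ :=
  sInf {l | HasKernelRep B l}

/-- Controllability: any trajectory can be left at any time and steered to any other one. -/
def IsControllable {V : Type*} (B : Set (ℕ → V → ℝ)) : Prop :=
  ∀ w₁ ∈ B, ∀ w₂ ∈ B, ∀ k₁ : ℕ, ∃ k₂ ≥ k₁, ∃ w ∈ B,
    (∀ t ≤ k₁, w t = w₁ t) ∧ (∀ t ≥ k₂, w t = w₂ t)

/-- `(u, d)` is the input and `y` the (nonanticipating) output of the behavior `B`. -/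
structure IsInputOutput {Y U D : Type*} (B : Set (ℕ → Y ⊕ U ⊕ D → ℝ)) : Prop where
  /-- the input is free -/
  free : ∀ v : ℕ → U ⊕ D → ℝ, ∃ w ∈ B, ∀ t i, w t (Sum.inr i) = v t i
  /-- the output up to time `k` is not affected by the input after time `k` -/
  nonanticipating : ∀ w ∈ B, ∀ w' ∈ B, ∀ k : ℕ,
    (∀ t ≤ k, ∀ i, w t (Sum.inr i) = w' t (Sum.inr i)) →
    ∃ w'' ∈ B, (∀ t i, w'' t (Sum.inr i) = w' t (Sum.inr i)) ∧
      ∀ t ≤ k, ∀ i, w'' t (Sum.inl i) = w t (Sum.inl i)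
  /-- nothing is left free in the output once the input is fixed: with zero input the behavior
  is autonomous -/
  not_free : ∃ N : ℕ, ∀ w ∈ B, (∀ t i, w t (Sum.inr i) = 0) → (∀ t < N, w t = 0) →
    ∀ t, w t = 0

/-- The `(L+1)`-step behavior: all restrictions of trajectories to `L + 1` consecutive steps. -/
def windows {V : Type*} (B : Set (ℕ → V → ℝ)) (L : ℕ) : Set (Fin (L + 1) × V → ℝ) :=
  {v | ∃ w ∈ B, ∃ k : ℕ, ∀ p : Fin (L + 1) × V, v p = w (k + p.1) p.2}

/-! ### Design data and the derived matrices -/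

/-- The matrices the design starts from: the parameterizing matrix `F` of the `(L+1)`-step
behavior, a matrix `Fz`, and the covariances of `Δd`, `Δu` and the measurement noise. -/
structure DesignData (L : ℕ) (Y U D G : Type*) where
  F : Matrix (Fin (L + 1) × (Y ⊕ U ⊕ D)) G ℝ
  Fz : Matrix G U ℝ
  Sd : Matrix D D ℝ
  Su : Matrix U U ℝ
  Sn : Matrix (Y ⊕ U ⊕ D) (Y ⊕ U ⊕ D) ℝ

namespace DesignData

variable {L : ℕ} {Y U D G : Type*}
  [Fintype Y] [Fintype U] [Fintype D] [Fintype G]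
  [DecidableEq Y] [DecidableEq U] [DecidableEq D] [DecidableEq G]

/-- `Π_f F`: the rows of `F` giving `w_k`, the last sample of the window `w_{k-L}, …, w_k`. -/
def F_w (S : DesignData L Y U D G) : Matrix (Y ⊕ U ⊕ D) G ℝ :=
  S.F.submatrix (fun c => (Fin.last L, c)) id

/-- `Π_y F`: the rows of `F` giving `y_k`. -/
def F_y (S : DesignData L Y U D G) : Matrix Y G ℝ :=
  S.F.submatrix (fun i => (Fin.last L, Sum.inl i)) id

/-- `Π_u F`: the rows of `F` giving `u_k`. -/
def F_u (S : DesignData L Y U D G) : Matrix U G ℝ :=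
  S.F.submatrix (fun i => (Fin.last L, Sum.inr (Sum.inl i))) id

/-- The rows of `F` giving `d_k`. -/
def F_dk (S : DesignData L Y U D G) : Matrix D G ℝ :=
  S.F.submatrix (fun i => (Fin.last L, Sum.inr (Sum.inr i))) id

/-- The rows of `F` giving `w_{k-L}, …, w_{k-1}`. -/
def F_wp (S : DesignData L Y U D G) : Matrix (Fin L × (Y ⊕ U ⊕ D)) G ℝ :=
  S.F.submatrix (fun p => (p.1.castSucc, p.2)) id

/-- `Π_p F`: the rows of `F` giving `w_{k-L+1}, …, w_k`. -/
def F_pp (S : DesignData L Y U D G) : Matrix (Fin L × (Y ⊕ U ⊕ D)) G ℝ :=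
  S.F.submatrix (fun p => (p.1.succ, p.2)) id

/-- The stacked matrix `col(F_wp, F_dk)`. -/
def stack (S : DesignData L Y U D G) : Matrix ((Fin L × (Y ⊕ U ⊕ D)) ⊕ D) G ℝ :=
  Matrix.fromRows S.F_wp S.F_dk

/-- `F_p`, the coefficient of `g_{k-1}` in the parameterizer dynamics. -/
noncomputable def Fp (S : DesignData L Y U D G) : Matrix G G ℝ :=
  pinv S.stack * Matrix.fromRows S.F_pp 0

/-- `F_f`, the coefficient of `d_k` in the parameterizer dynamics. -/
noncomputable def Ff (S : DesignData L Y U D G) : Matrix G D ℝ :=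
  pinv S.stack * Matrix.fromRows 0 1

/-- `F_z` has orthonormal columns, and its column space is that of `I - A† A`, where
`A = col(F_wp, F_dk)`. -/
def FzAdmissible (S : DesignData L Y U D G) : Prop :=
  S.Fzᵀ * S.Fz = 1 ∧
    LinearMap.range S.Fz.mulVecLin = LinearMap.range (1 - pinv S.stack * S.stack).mulVecLin

/-- `E_u = F_z (Π_u F F_z)⁻¹`. -/
noncomputable def Eu (S : DesignData L Y U D G) : Matrix G U ℝ :=
  S.Fz * (S.F_u * S.Fz)⁻¹

/-- `E_p = [I - F_z (Π_u F F_z)⁻¹ Π_u F] F_p`. -/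
noncomputable def Ep (S : DesignData L Y U D G) : Matrix G G ℝ :=
  (1 - S.Fz * (S.F_u * S.Fz)⁻¹ * S.F_u) * S.Fp

/-- `E_f = [I - F_z (Π_u F F_z)⁻¹ Π_u F] F_f`. -/
noncomputable def Ef (S : DesignData L Y U D G) : Matrix G D ℝ :=
  (1 - S.Fz * (S.F_u * S.Fz)⁻¹ * S.F_u) * S.Ff

/-! #### The filter -/

/-- Prior error covariance `P_{k|k-1}` from the posterior one `P_{k-1|k-1}`. -/
noncomputable def priorCov (S : DesignData L Y U D G) (P : Matrix G G ℝ) : Matrix G G ℝ :=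
  S.Ep * P * S.Epᵀ + S.Ef * S.Sd * S.Efᵀ + S.Eu * S.Su * S.Euᵀ

/-- Filter gain from the prior error covariance. -/
noncomputable def gain (S : DesignData L Y U D G) (P : Matrix G G ℝ) :
    Matrix G (Y ⊕ U ⊕ D) ℝ :=
  P * S.F_wᵀ * (S.F_w * P * S.F_wᵀ + S.Sn)⁻¹

/-- Posterior error covariances `P_{k|k}`, started from `P_{0|0} = P₀`. -/
noncomputable def postCov (S : DesignData L Y U D G) (P₀ : Matrix G G ℝ) : ℕ → Matrix G G ℝ
  | 0 => P₀
  | k + 1 => (1 - S.gain (S.priorCov (S.postCov P₀ k)) * S.F_w) * S.priorCov (S.postCov P₀ k)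

/-- The gain `K_{k+1}` used at time `k + 1`. -/
noncomputable def gainAt (S : DesignData L Y U D G) (P₀ : Matrix G G ℝ) (k : ℕ) :
    Matrix G (Y ⊕ U ⊕ D) ℝ :=
  S.gain (S.priorCov (S.postCov P₀ k))

/-! #### The algebraic Riccati equation -/

noncomputable def calQ (S : DesignData L Y U D G) : Matrix G G ℝ :=
  S.Ef * S.Sd * S.Efᵀ + S.Eu * S.Su * S.Euᵀ

noncomputable def calA (S : DesignData L Y U D G) : Matrix (Y ⊕ U ⊕ D) G ℝ :=
  S.F_w * S.Ep

noncomputable def calR (S : DesignData L Y U D G) : Matrix (Y ⊕ U ⊕ D) (Y ⊕ U ⊕ D) ℝ :=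
  S.F_w * (S.Ef * S.Sd * S.Efᵀ + S.Eu * S.Su * S.Euᵀ) * S.F_wᵀ + S.Sn

noncomputable def calT (S : DesignData L Y U D G) : Matrix (Y ⊕ U ⊕ D) G ℝ :=
  S.F_w * (S.Ef * S.Sd * S.Efᵀ + S.Eu * S.Su * S.Euᵀ)

noncomputable def calN (S : DesignData L Y U D G) (P : Matrix G G ℝ) : Matrix G G ℝ :=
  (S.calA * P * S.Epᵀ + S.calT)ᵀ * (S.calA * P * S.calAᵀ + S.calR)⁻¹ *
    (S.calA * P * S.Epᵀ + S.calT)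

/-- `P` is a (positive semidefinite) solution of the algebraic Riccati equation. -/
def SolvesARE (S : DesignData L Y U D G) (P : Matrix G G ℝ) : Prop :=
  P.PosSemidef ∧ P = S.Ep * P * S.Epᵀ - S.calN P + S.calQ

/-! #### The matrix inequalities -/

/-- The `3 × 3` block matrix with rows
`[X, *, *]`, `[N^{1/2}, W, *]`, `[Π_y F P^{1/2}, 0, I]`. -/
noncomputable def offsetBlock (S : DesignData L Y U D G) (P W X : Matrix G G ℝ) :
    Matrix ((G ⊕ G) ⊕ Y) ((G ⊕ G) ⊕ Y) ℝ :=
  Matrix.fromBlocks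
    (Matrix.fromBlocks X (msqrt (S.calN P))ᵀ (msqrt (S.calN P)) W)
    (Matrix.fromCols (S.F_y * msqrt P) 0)ᵀ
    (Matrix.fromCols (S.F_y * msqrt P) 0)
    1

/-- The lower left `2 × 2` blocks of `dissBlock`. -/
noncomputable def dissLower (S : DesignData L Y U D G) (W : Matrix G G ℝ)
    (Yg : Matrix U G ℝ) (Kd : Matrix U D ℝ) : Matrix (Y ⊕ G) (G ⊕ D) ℝ :=
  Matrix.fromBlocks (S.F_y * W) 0 (S.Fp * W + S.Fz * Yg) (S.Ff + S.Fz * Kd)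

/-- The `4 × 4` block matrix with rows `[W, *, *, *]`, `[0, γ₁² I, *, *]`, `[Π_y F W, 0, I, *]`,
`[F_p W + F_z Y_g, F_f + F_z K_d, 0, W]`. -/
noncomputable def dissBlock (S : DesignData L Y U D G) (γ₁ : ℝ) (W : Matrix G G ℝ)
    (Yg : Matrix U G ℝ) (Kd : Matrix U D ℝ) :
    Matrix ((G ⊕ D) ⊕ (Y ⊕ G)) ((G ⊕ D) ⊕ (Y ⊕ G)) ℝ :=
  Matrix.fromBlocks
    (Matrix.fromBlocks W 0 0 (γ₁ ^ 2 • (1 : Matrix D D ℝ)))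
    (S.dissLower W Yg Kd)ᵀ
    (S.dissLower W Yg Kd)
    (Matrix.fromBlocks 1 0 0 W)

/-- The design conditions on `W`, `X`, `Y_g`, `K_d`. -/
structure LMIs (S : DesignData L Y U D G) (P : Matrix G G ℝ) (γ₁ γ₂ : ℝ)
    (W X : Matrix G G ℝ) (Yg : Matrix U G ℝ) (Kd : Matrix U D ℝ) : Prop where
  pos : W.PosDef
  offset_trace : 0 ≤ γ₂ ^ 2 * S.Sd.trace - X.trace
  offset : (S.offsetBlock P W X).PosSemidef
  diss : (S.dissBlock γ₁ W Yg Kd).PosSemidef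

/-! #### The closed loop -/

/-- The closed loop. The sample `w t` is the manifest variable at time `t - L`, so that `w (L + k)`
is its value at time `k`, and the window at time `k` consists of `w k, …, w (k + L)`.
`m k` is the mean of the disturbance at time `k`, and `gprior k`, `gpost k` are the prior and
posterior estimates of the parameterizer at time `k`. The controller is active from time `1` on. -/
structure IsClosedLoop {Ω : Type*} (S : DesignData L Y U D G) (B : Set (ℕ → Y ⊕ U ⊕ D → ℝ))
    (P₀ W : Matrix G G ℝ) (Yg : Matrix U G ℝ) (Kd : Matrix U D ℝ) (m : ℕ → D → ℝ)
    (Δd : ℕ → Ω → D → ℝ) (Δu : ℕ → Ω → U → ℝ) (n : ℕ → Ω → Y ⊕ U ⊕ D → ℝ)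
    (g₀ ghat₀ : Ω → G → ℝ)
    (w : ℕ → Ω → Y ⊕ U ⊕ D → ℝ) (gprior gpost : ℕ → Ω → G → ℝ) : Prop where
  /-- every sample path is a trajectory of the plant -/
  mem : ∀ ω, (fun t => w t ω) ∈ B
  /-- the window at time `0` has parameterizer `g₀` -/
  init_window : ∀ ω (p : Fin (L + 1) × (Y ⊕ U ⊕ D)), w p.1 ω p.2 = (S.F *ᵥ g₀ ω) p
  /-- the filter starts from the estimate `ghat₀` -/
  init_estimate : gpost 0 = ghat₀
  /-- prior estimate, which determines the control action -/
  control : ∀ k ω, gprior (k + 1) ω =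
    (S.Fp + S.Fz * Yg * W⁻¹) *ᵥ gpost k ω + (S.Ff + S.Fz * Kd) *ᵥ m (k + 1)
  /-- the input is the control action `Π_u F ĝ_{k|k-1}` plus its uncertainty -/
  input : ∀ k ω i, w (L + (k + 1)) ω (Sum.inr (Sum.inl i)) =
    (S.F_u *ᵥ gprior (k + 1) ω) i + Δu (k + 1) ω i
  /-- the disturbance is its mean plus a deviation -/
  disturbance : ∀ k ω i, w (L + (k + 1)) ω (Sum.inr (Sum.inr i)) =
    m (k + 1) i + Δd (k + 1) ω i
  /-- posterior update with the measurement `w + n` -/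
  update : ∀ k ω, gpost (k + 1) ω = gprior (k + 1) ω +
    S.gainAt P₀ k *ᵥ (w (L + (k + 1)) ω + n (k + 1) ω - S.F_w *ᵥ gprior (k + 1) ω)

end DesignData

/-! ### Stochastic signals -/

/-- Zero-mean white noise with covariance matrix `S`. -/
structure IsWhiteNoise {Ω ι : Type*} [MeasurableSpace Ω] (μ : Measure Ω) (S : Matrix ι ι ℝ)
    (ξ : ℕ → Ω → ι → ℝ) : Prop where
  measurable : ∀ k, Measurable (ξ k)
  memLp : ∀ k i, MemLp (fun ω => ξ k ω i) 2 μ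
  mean : ∀ k i, ∫ ω, ξ k ω i ∂μ = 0
  cov : ∀ j k a b, ∫ ω, ξ j ω a * ξ k ω b ∂μ = if j = k then S a b else 0

/-- Independent, identically distributed zero-mean noise with covariance matrix `S`. -/
structure IsIIDNoise {Ω ι : Type*} [MeasurableSpace Ω] (μ : Measure Ω) (S : Matrix ι ι ℝ)
    (ξ : ℕ → Ω → ι → ℝ) : Prop extends IsWhiteNoise μ S ξ where
  indep : iIndepFun ξ μ
  ident : ∀ k, IdentDistrib (ξ k) (ξ 0) μ μ

/-- Assumptions on the uncertainties at times `1, 2, …`: `Δd` and `Δu` are i.i.d., `n` is white,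
all with mean zero and the given covariances, and the three are pairwise independent. -/
structure NoiseModel {Ω Y U D G : Type*} [MeasurableSpace Ω] {L : ℕ} (μ : Measure Ω)
    (S : DesignData L Y U D G)
    (Δd : ℕ → Ω → D → ℝ) (Δu : ℕ → Ω → U → ℝ) (n : ℕ → Ω → Y ⊕ U ⊕ D → ℝ) : Prop where
  dist : IsIIDNoise μ S.Sd (fun k => Δd (k + 1))
  input : IsIIDNoise μ S.Su (fun k => Δu (k + 1))
  meas : IsWhiteNoise μ S.Sn (fun k => n (k + 1))
  indep_du : IndepFun (fun ω k => Δd (k + 1) ω) (fun ω k => Δu (k + 1) ω) μ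
  indep_dn : IndepFun (fun ω k => Δd (k + 1) ω) (fun ω k => n (k + 1) ω) μ
  indep_un : IndepFun (fun ω k => Δu (k + 1) ω) (fun ω k => n (k + 1) ω) μ

/-- Assumptions on the initial parameterizer `g₀` and its initial estimate `ghat₀`: they are square
integrable and independent of the later uncertainties, and the initial estimation error
`g₀ - ghat₀` has mean zero and covariance `P₀`, and is uncorrelated with `ghat₀`. -/
structure InitialModel {Ω Y U D G : Type*} [MeasurableSpace Ω] (μ : Measure Ω)
    (P₀ : Matrix G G ℝ)
    (Δd : ℕ → Ω → D → ℝ) (Δu : ℕ → Ω → U → ℝ) (n : ℕ → Ω → Y ⊕ U ⊕ D → ℝ)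
    (g₀ ghat₀ : Ω → G → ℝ) : Prop where
  measurable_g : Measurable g₀
  measurable_ghat : Measurable ghat₀
  memLp_g : ∀ i, MemLp (fun ω => g₀ ω i) 2 μ
  memLp_ghat : ∀ i, MemLp (fun ω => ghat₀ ω i) 2 μ
  mean_err : ∀ i, ∫ ω, (g₀ ω i - ghat₀ ω i) ∂μ = 0
  cov_err : ∀ i j, ∫ ω, (g₀ ω i - ghat₀ ω i) * (g₀ ω j - ghat₀ ω j) ∂μ = P₀ i j
  uncorrelated : ∀ i j, ∫ ω, ghat₀ ω i * (g₀ ω j - ghat₀ ω j) ∂μ = 0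
  indep_d : IndepFun (fun ω => (g₀ ω, ghat₀ ω)) (fun ω k => Δd (k + 1) ω) μ
  indep_u : IndepFun (fun ω => (g₀ ω, ghat₀ ω)) (fun ω k => Δu (k + 1) ω) μ
  indep_n : IndepFun (fun ω => (g₀ ω, ghat₀ ω)) (fun ω k => n (k + 1) ω) μ

/-- The truncated gain `Γ_T = ‖y_{[1,T]}‖ / ‖d_{[1,T]}‖` (Euclidean norms) of a sample path `w`,
whose value at time `k` is `w (L + k)`. It is `∞` if `d_{[1,T]} = 0` and `y_{[1,T]} ≠ 0`. -/
noncomputable def truncGain {Y U D : Type*} [Fintype Y] [Fintype D] (L : ℕ)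
    (w : ℕ → Y ⊕ U ⊕ D → ℝ) (T : ℕ) : ENNReal :=
  ENNReal.ofReal (Real.sqrt (∑ k ∈ Finset.Icc 1 T, ∑ i, w (L + k) (Sum.inl i) ^ 2)) /
    ENNReal.ofReal (Real.sqrt (∑ k ∈ Finset.Icc 1 T, ∑ i, w (L + k) (Sum.inr (Sum.inr i)) ^ 2))

/-- `(1/T) ∑_{k=1}^T ‖m_k‖²`. -/
noncomputable def meanEnergy {D : Type*} [Fintype D] (m : ℕ → D → ℝ) (T : ℕ) : ℝ :=
  (1 / (T : ℝ)) * ∑ k ∈ Finset.Icc 1 T, ∑ i, m k i ^ 2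

/-! The argument is a stochastic dissipation inequality for the estimated parameterizer, followed by
a comparison of the energies of output and disturbance.

Past samples, `u_k` and `d_k` determine a window (`Parameterizes.eq_zero`), so parameterizers obey
`g_{k+1} = E_p g_k + E_f d + E_u u` (`Parameterizes.next_eq`). The controller's prediction obeys the
same recursion with `d` and `u` replaced by their means (`Parameterizes.control_eq`). The prediction
error is therefore driven by noise alone, and the filter is a Kalman filter: estimate and error stay
orthogonal, the error covariance follows the Riccati recursion, and the innovation adds `calN` to
the second moment of the estimate (`FilterState.step`).

Take `x ⬝ᵥ W⁻¹ *ᵥ x` as storage. A Schur complement of the large matrix inequality gives pathwise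
dissipation with gain `γ₁` from the mean disturbance (`LMIs.dissipation`). Taking expectations and
telescoping bounds the mean output energy by a constant plus `γ₁²` times the energy of `m` plus the
sum of the noise costs (`IsClosedLoop.energy_le`). These costs converge because the error
covariances converge to `P` (`NoisePos.tendsto_postCov`), and the other matrix inequality bounds
their limit by `γ₂² tr S_d` (`LMIs.trace_le`).

Controllability of the behavior enters through null controllability of the parameterizer. It makes
the steady-state filter error dynamics stable, which yields both uniqueness of the fixed point and
convergence to it.

Finally, the law of large numbers and Chebyshev's inequality show that the disturbance energy is,
with probability tending to one, at least `1 - ε` times its mean. Markov's inequality bounds the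
probability that the output energy is large. Letting `ε → 0` gives the claim
(`IsIIDNoise.liminf_energy_le`). -/

set_option linter.unusedSectionVars false

/-! ### Linear time-invariant behaviors -/

section Behavior

variable {V : Type*} [Fintype V]

/-- A behavior that is a linear shift-invariant space whose trajectories are recognised by their
windows of length `L + 1`. -/
structure IsFiniteMemory (B : Set (ℕ → V → ℝ)) (L : ℕ) : Prop where
  zero_mem : 0 ∈ B
  add_mem : ∀ {w w'}, w ∈ B → w' ∈ B → w + w' ∈ B
  shift_mem : ∀ {w}, w ∈ B → ∀ k, (fun t => w (k + t)) ∈ B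
  mem_of_windows : ∀ w : ℕ → V → ℝ,
    (∀ k, ∃ w' ∈ B, ∃ j, ∀ i ≤ L, w (k + i) = w' (j + i)) → w ∈ B

/-- A kernel equation of order `lag B` involves only `lag B + 1 ≤ L + 1` consecutive samples, so it
can be checked window by window. The lag is attained because the set of orders is nonempty. -/
theorem IsLTI.isFiniteMemory {B : Set (ℕ → V → ℝ)} {L : ℕ} (hB : IsLTI B) (hL : lag B ≤ L) :
    IsFiniteMemory B L := by
  have hmem : HasKernelRep B (lag B) := Nat.sInf_mem (s := {l | HasKernelRep B l}) hB
  obtain ⟨q, R, hR⟩ := hmem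
  generalize lag B = l at *
  subst hR
  refine ⟨?_, ?_, ?_, ?_⟩
  · intro t
    simp
  · intro w w' h h' t
    have := congrArg₂ (· + ·) (h t) (h' t)
    simpa [Matrix.mulVec_add, Finset.sum_add_distrib] using this
  · intro w h k t
    have := h (k + t)
    simpa [add_assoc] using this
  · intro w h t
    obtain ⟨w', hw', j, hj⟩ := h t
    have := hw' j
    rw [← this]
    refine Finset.sum_congr rfl fun i _ => ?_
    rw [hj i (by have := i.2; omega)]

end Behavior

section InputOutput

variable {Y U D : Type*} [Fintype Y] [Fintype U] [Fintype D]
  {B : Set (ℕ → Y ⊕ U ⊕ D → ℝ)} {L : ℕ}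

/-- A trajectory that vanishes for `L` steps and whose next input vanishes has vanishing next
output. -/
theorem IsInputOutput.eq_zero_of_past (hio : IsInputOutput B) (hB : IsFiniteMemory B L)
    {w : ℕ → Y ⊕ U ⊕ D → ℝ} (hw : w ∈ B) (hpast : ∀ t < L, w t = 0)
    (hin : ∀ i, w L (Sum.inr i) = 0) : w L = 0 := by
  obtain ⟨N, hN⟩ := hio.not_free
  -- Delay by `N` zero samples, so that `not_free` becomes applicable. As `w` starts with `L` zeros,
  -- each window of the delayed sequence is a window of `0` or of `w`, and the sequence stays in
  -- `B`.
  set w' : ℕ → Y ⊕ U ⊕ D → ℝ := fun t => if t < N then 0 else w (t - N) with hw'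
  have hz : ∀ t < N + L, w' t = 0 := by
    intro t ht
    by_cases h : t < N
    · simp [hw', h]
    · simp only [hw', h, if_false]
      exact hpast _ (by omega)
  have hNL : w' (N + L) = w L := by simp [hw']
  have hw'B : w' ∈ B := by
    refine hB.mem_of_windows _ fun k => ?_
    by_cases h : k < N
    · exact ⟨0, hB.zero_mem, 0, fun i hi => hz _ (by omega)⟩
    · refine ⟨w, hw, k - N, fun i hi => ?_⟩
      have h1 : ¬ (k + i < N) := by omega
      simp only [hw', h1, if_false]
      congr 1
      omega
  -- The input after time `N + L` is replaced by zero without changing the output up to that time.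
  -- The new trajectory has zero input and starts with `N` zeros, hence vanishes.
  obtain ⟨w'', hw''B, hin'', hout''⟩ := hio.nonanticipating w' hw'B 0 hB.zero_mem (N + L) (by
    intro t ht i
    rcases Nat.lt_or_ge t (N + L) with h | h
    · simp [hz t h]
    · obtain rfl : t = N + L := by omega
      simp [hNL, hin i])
  have h0 : ∀ t, w'' t = 0 := by
    refine hN w'' hw''B (fun t i => by simp [hin'']) fun t ht => ?_
    funext c
    rcases c with c | c
    · rw [hout'' t (by omega) c, hz t (by omega)]
    · simp [hin'']
  funext c
  rcases c with c | c
  · rw [← hNL, ← hout'' _ le_rfl, h0]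
  · simpa using hin c

/-- A trajectory can be modified after time `k` so as to have a prescribed input at time
`k + 1`. -/
theorem IsInputOutput.exists_next (hio : IsInputOutput B) (hB : IsFiniteMemory B L)
    {w : ℕ → Y ⊕ U ⊕ D → ℝ} (hw : w ∈ B) (k : ℕ) (v : U ⊕ D → ℝ) :
    ∃ w' ∈ B, (∀ t ≤ k, w' t = w t) ∧ ∀ i, w' (k + 1) (Sum.inr i) = v i := by
  obtain ⟨z, hz, hzin⟩ := hio.free
    (fun t i => if t ≤ k then 0 else v i - w t (Sum.inr i))
  -- Freeness alone leaves the early output of the correction arbitrary. Comparison with the zero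
  -- trajectory makes it vanish up to time `k`.
  obtain ⟨z', hz', hin, hout⟩ := hio.nonanticipating 0 hB.zero_mem z hz k
    (fun t ht i => by simp [hzin, ht])
  refine ⟨w + z', hB.add_mem hw hz', fun t ht => ?_, fun i => ?_⟩
  · funext c
    rcases c with c | c
    · simp [hout t ht]
    · simp [hin, hzin, ht]
  · simp [hin, hzin]

end InputOutput

/-! ### The parameterizer dynamics -/

namespace DesignData

variable {L : ℕ} {Y U D G : Type*}
  [Fintype Y] [Fintype U] [Fintype D] [Fintype G]
  [DecidableEq Y] [DecidableEq U] [DecidableEq D] [DecidableEq G]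
  {S : DesignData L Y U D G}

theorem Fp_mulVec (g : G → ℝ) :
    S.Fp *ᵥ g = pinv S.stack *ᵥ (Matrix.fromRows S.F_pp 0 *ᵥ g) :=
  (Matrix.mulVec_mulVec _ _ _).symm

theorem Ff_mulVec (d : D → ℝ) :
    S.Ff *ᵥ d = pinv S.stack *ᵥ (Matrix.fromRows 0 1 *ᵥ d) :=
  (Matrix.mulVec_mulVec _ _ _).symm

/-- `A (I - A† A) = 0` by the first Penrose equation: the columns of `F_z` are directions invisible
to past samples and present disturbance. -/
theorem stack_mul_Fz (hFz : S.FzAdmissible) : S.stack * S.Fz = 0 := by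
  apply Matrix.ext_of_mulVec_single
  intro i
  have hmem : S.Fz.mulVecLin (Pi.single i 1) ∈
      LinearMap.range (1 - pinv S.stack * S.stack).mulVecLin := hFz.2 ▸ ⟨_, rfl⟩
  obtain ⟨x, hx⟩ := hmem
  simp only [Matrix.mulVecLin_apply] at hx
  rw [← Matrix.mulVec_mulVec, ← hx, Matrix.mulVec_mulVec, Matrix.mul_sub, Matrix.mul_one,
    ← Matrix.mul_assoc, (pinv_penrose S.stack).1, sub_self, Matrix.zero_mulVec,
    Matrix.zero_mulVec]

/-- The parameterization `F` of the `(L+1)`-step behavior, together with `F_z`. -/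
structure Parameterizes (S : DesignData L Y U D G) (B : Set (ℕ → Y ⊕ U ⊕ D → ℝ)) : Prop where
  injective : Function.Injective S.F.mulVec
  range : Set.range S.F.mulVec = windows B L
  admissible : S.FzAdmissible
  io : IsInputOutput B
  memory : IsFiniteMemory B L

/-- `g` parameterizes the window of `w` that starts at time `k`. -/
def IsParam (S : DesignData L Y U D G) (w : ℕ → Y ⊕ U ⊕ D → ℝ) (k : ℕ) (g : G → ℝ) : Prop :=
  ∀ p : Fin (L + 1) × (Y ⊕ U ⊕ D), (S.F *ᵥ g) p = w (k + p.1) p.2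

section

variable {B : Set (ℕ → Y ⊕ U ⊕ D → ℝ)} (h : S.Parameterizes B)
include h

theorem Parameterizes.exists_param {w : ℕ → Y ⊕ U ⊕ D → ℝ} (hw : w ∈ B) (k : ℕ) :
    ∃ g, S.IsParam w k g := by
  have hmem : (fun p : Fin (L + 1) × (Y ⊕ U ⊕ D) => w (k + p.1) p.2) ∈ windows B L :=
    ⟨w, hw, k, fun _ => rfl⟩
  rw [← h.range] at hmem
  obtain ⟨g, hg⟩ := hmem
  exact ⟨g, fun p => congrFun hg p⟩

theorem Parameterizes.exists_trajectory (g : G → ℝ) : ∃ w ∈ B, S.IsParam w 0 g := by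
  have hmem : S.F *ᵥ g ∈ windows B L := h.range ▸ ⟨g, rfl⟩
  obtain ⟨w, hw, k, hk⟩ := hmem
  exact ⟨_, h.memory.shift_mem hw k, fun p => by simpa using hk p⟩

/-- The window of `g` has zero past and zero present input, so its last output vanishes too by
`IsInputOutput.eq_zero_of_past`; injectivity of `F` then gives `g = 0`. -/
theorem Parameterizes.eq_zero {g : G → ℝ} (hs : S.stack *ᵥ g = 0) (hu : S.F_u *ᵥ g = 0) :
    g = 0 := by
  obtain ⟨w, hw, hg⟩ := h.exists_trajectory g
  have hpast : ∀ t < L, w t = 0 := by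
    intro t ht
    funext c
    have h1 := congrFun hs (Sum.inl (⟨t, ht⟩, c))
    have h2 := hg (Fin.castSucc ⟨t, ht⟩, c)
    simp only [Fin.val_castSucc, zero_add] at h2
    rw [← h2]
    exact h1
  have hlast : ∀ c, w L c = (S.F *ᵥ g) (Fin.last L, c) := fun c => by
    rw [hg]; simp
  have h0 : w L = 0 := by
    refine h.io.eq_zero_of_past h.memory hw hpast ?_
    rintro (i | i)
    · rw [hlast]; exact congrFun hu i
    · rw [hlast]; exact congrFun hs (Sum.inr i)
  apply h.injective
  rw [Matrix.mulVec_zero]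
  funext p
  rw [hg, zero_add]
  rcases Nat.lt_or_ge p.1 L with hp | hp
  · rw [hpast _ hp]; rfl
  · have : (p.1 : ℕ) = L := by have := p.1.2; omega
    rw [this, h0]; rfl

/-- The matrix is square, so injectivity suffices. A kernel vector `z` makes `F_z z` invisible to
past, disturbance and input, so `F_z z = 0`, and `z = 0` by orthonormality. -/
theorem Parameterizes.isUnit_Fu_Fz : IsUnit (S.F_u * S.Fz) := by
  rw [← Matrix.mulVec_injective_iff_isUnit]
  rw [← Matrix.coe_mulVecLin, injective_iff_map_eq_zero]
  intro z hz
  simp only [Matrix.mulVecLin_apply] at hz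
  have h0 : S.Fz *ᵥ z = 0 := by
    refine h.eq_zero ?_ ?_
    · rw [Matrix.mulVec_mulVec, stack_mul_Fz h.admissible, Matrix.zero_mulVec]
    · rw [Matrix.mulVec_mulVec, hz]
  rw [← Matrix.one_mulVec z, ← h.admissible.1, ← Matrix.mulVec_mulVec, h0, Matrix.mulVec_zero]

/-- Consequently `1 - S.Eu * S.F_u` annihilates `F_z`, which is how unknown or controller-chosen
components along `F_z` are eliminated below. -/
theorem Parameterizes.Eu_Fu_Fz : S.Eu * S.F_u * S.Fz = S.Fz := by
  have hdet := (Matrix.isUnit_iff_isUnit_det _).1 h.isUnit_Fu_Fz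
  rw [Eu, Matrix.mul_assoc, Matrix.mul_assoc, Matrix.nonsing_inv_mul _ hdet, Matrix.mul_one]

/-- The parameterizer of the next window from the present one and the new input. -/
theorem Parameterizes.next_eq {g g' : G → ℝ} (hp : S.F_wp *ᵥ g' = S.F_pp *ᵥ g) :
    g' = S.Ep *ᵥ g + S.Ef *ᵥ (S.F_dk *ᵥ g') + S.Eu *ᵥ (S.F_u *ᵥ g') := by
  have h1 : S.stack *ᵥ g' = Sum.elim (S.F_pp *ᵥ g) (S.F_dk *ᵥ g') := by
    rw [stack, Matrix.fromRows_mulVec, hp]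
  have h2 : pinv S.stack *ᵥ (S.stack *ᵥ g') = S.Fp *ᵥ g + S.Ff *ᵥ (S.F_dk *ᵥ g') := by
    rw [h1, Fp_mulVec, Ff_mulVec, ← Matrix.mulVec_add, Matrix.fromRows_mulVec,
      Matrix.fromRows_mulVec]
    congr 1
    funext i
    rcases i with i | i <;> simp
  have h3 : (1 - pinv S.stack * S.stack).mulVecLin g' ∈ LinearMap.range S.Fz.mulVecLin :=
    h.admissible.2 ▸ ⟨_, rfl⟩
  obtain ⟨z, hz⟩ := h3
  simp only [Matrix.mulVecLin_apply] at hz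
  -- General solution of a linear system: the part `A† A g'` is known, and the remainder `F_z z` is
  -- removed in the next step by `1 - E_u Π_u F`.
  have h4 : g' = S.Fp *ᵥ g + S.Ff *ᵥ (S.F_dk *ᵥ g') + S.Fz *ᵥ z := by
    rw [hz, ← h2, Matrix.sub_mulVec, Matrix.one_mulVec, ← Matrix.mulVec_mulVec]
    abel
  have h5 : (1 - S.Eu * S.F_u) *ᵥ g' = S.Ep *ᵥ g + S.Ef *ᵥ (S.F_dk *ᵥ g') := by
    conv_lhs => rw [h4]
    rw [Matrix.mulVec_add, Matrix.mulVec_mulVec (M := 1 - _) (N := S.Fz), Matrix.sub_mul,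
      h.Eu_Fu_Fz, Matrix.one_mul, sub_self, Matrix.zero_mulVec, add_zero, Matrix.mulVec_add,
      Matrix.mulVec_mulVec, Matrix.mulVec_mulVec]
    rfl
  rw [← h5, Matrix.sub_mulVec, Matrix.one_mulVec, Matrix.mulVec_mulVec]
  abel

omit h in
theorem IsParam.shift {w : ℕ → Y ⊕ U ⊕ D → ℝ} {k : ℕ} {g g' : G → ℝ} (hg : S.IsParam w k g)
    (hg' : S.IsParam w (k + 1) g') : S.F_wp *ᵥ g' = S.F_pp *ᵥ g := by
  funext p
  have h1 := hg (p.1.succ, p.2)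
  have h2 := hg' (p.1.castSucc, p.2)
  refine h2.trans (Eq.trans ?_ h1.symm)
  simp only [Fin.val_castSucc, Fin.val_succ]
  congr 1
  omega

omit h in
theorem IsParam.F_w {w : ℕ → Y ⊕ U ⊕ D → ℝ} {k : ℕ} {g : G → ℝ} (hg : S.IsParam w k g) :
    S.F_w *ᵥ g = w (k + L) :=
  funext fun c => hg (Fin.last L, c)

/-- Extending a trajectory of `g` by the free input `(u, d)` produces some next parameterizer, and
`Parameterizes.next_eq` forces it to be the given expression. -/
theorem Parameterizes.exists_next_param (g : G → ℝ) (u : U → ℝ) (d : D → ℝ) :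
    S.F_wp *ᵥ (S.Ep *ᵥ g + S.Ef *ᵥ d + S.Eu *ᵥ u) = S.F_pp *ᵥ g ∧
      S.F_dk *ᵥ (S.Ep *ᵥ g + S.Ef *ᵥ d + S.Eu *ᵥ u) = d ∧
      S.F_u *ᵥ (S.Ep *ᵥ g + S.Ef *ᵥ d + S.Eu *ᵥ u) = u := by
  obtain ⟨w, hw, hg⟩ := h.exists_trajectory g
  obtain ⟨w', hw', heq, hin⟩ := h.io.exists_next h.memory hw L (Sum.elim u d)
  obtain ⟨g', hg'⟩ := h.exists_param hw' 1
  have hg0 : S.IsParam w' 0 g := fun p => by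
    rw [hg p, heq _ (by have := p.1.2; omega)]
  have hp := hg0.shift hg'
  have hlast : ∀ c, (S.F *ᵥ g') (Fin.last L, c) = w' (L + 1) c := fun c => by
    rw [hg', add_comm]; rfl
  have hd : S.F_dk *ᵥ g' = d := funext fun i => (hlast _).trans (hin (Sum.inr i))
  have hu : S.F_u *ᵥ g' = u := funext fun i => (hlast _).trans (hin (Sum.inl i))
  have hn := h.next_eq hp
  rw [hd, hu] at hn
  rw [← hn]
  exact ⟨hp, hd, hu⟩

/-- Parameterizers of consecutive windows define a trajectory. -/
theorem Parameterizes.mem_of_params {w : ℕ → Y ⊕ U ⊕ D → ℝ}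
    (hw : ∀ k, ∃ g, S.IsParam w k g) : w ∈ B := by
  refine h.memory.mem_of_windows w fun k => ?_
  obtain ⟨g, hg⟩ := hw k
  obtain ⟨w', hw', hg'⟩ := h.exists_trajectory g
  refine ⟨w', hw', 0, fun i hi => funext fun c => ?_⟩
  exact (hg (⟨i, by omega⟩, c)).symm.trans (hg' _)

/-- Every parameterizer can be steered to zero. -/
theorem Parameterizes.null_controllable (hc : IsControllable B) (g : G → ℝ) :
    ∃ (N : ℕ) (x : ℕ → G → ℝ) (d : ℕ → D → ℝ) (u : ℕ → U → ℝ), x 0 = g ∧ x N = 0 ∧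
      ∀ k, x (k + 1) = S.Ep *ᵥ x k + S.Ef *ᵥ d k + S.Eu *ᵥ u k := by
  obtain ⟨w₁, hw₁, hg₁⟩ := h.exists_trajectory g
  -- The trajectory of `g` is left only after time `L`, so the window at time `0` is intact. The
  -- inputs are then read off from the parameterizers of the connecting trajectory.
  obtain ⟨N, -, w, hw, hleft, hright⟩ := hc w₁ hw₁ 0 h.memory.zero_mem L
  choose x hx using fun k => h.exists_param hw k
  refine ⟨N, x, fun k => S.F_dk *ᵥ x (k + 1), fun k => S.F_u *ᵥ x (k + 1), ?_, ?_, fun k => ?_⟩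
  · apply h.injective
    funext p
    rw [hx, hg₁, hleft _ (by have := p.1.2; omega)]
  · apply h.injective
    funext p
    rw [hx, hright _ (by omega), Matrix.mulVec_zero]
    rfl
  · exact h.next_eq ((hx k).shift (hx (k + 1)))

end

/-- The one-step prediction of the controller is the parameterizer prediction driven by the mean
disturbance and the control action. -/
theorem Parameterizes.control_eq {B : Set (ℕ → Y ⊕ U ⊕ D → ℝ)} (h : S.Parameterizes B)
    (H : Matrix U G ℝ) (Kd : Matrix U D ℝ) (g : G → ℝ) (m : D → ℝ) :
    (S.Fp + S.Fz * H) *ᵥ g + (S.Ff + S.Fz * Kd) *ᵥ m =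
      S.Ep *ᵥ g + S.Ef *ᵥ m +
        S.Eu *ᵥ (S.F_u *ᵥ ((S.Fp + S.Fz * H) *ᵥ g + (S.Ff + S.Fz * Kd) *ᵥ m)) := by
  -- The feedback acts along `F_z`, so the projection removes it and the result does not depend on
  -- `H`; likewise for `Kd`.
  have e1 : (1 - S.Eu * S.F_u) * (S.Fp + S.Fz * H) = S.Ep := by
    rw [Matrix.mul_add, ← Matrix.mul_assoc, Matrix.sub_mul 1 _ S.Fz, h.Eu_Fu_Fz, Matrix.one_mul,
      sub_self, Matrix.zero_mul, add_zero]
    rfl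
  have e2 : (1 - S.Eu * S.F_u) * (S.Ff + S.Fz * Kd) = S.Ef := by
    rw [Matrix.mul_add, ← Matrix.mul_assoc, Matrix.sub_mul 1 _ S.Fz, h.Eu_Fu_Fz, Matrix.one_mul,
      sub_self, Matrix.zero_mul, add_zero]
    rfl
  set x := (S.Fp + S.Fz * H) *ᵥ g + (S.Ff + S.Fz * Kd) *ᵥ m with hx
  have e3 : (1 - S.Eu * S.F_u) *ᵥ x = S.Ep *ᵥ g + S.Ef *ᵥ m := by
    rw [hx, Matrix.mulVec_add, Matrix.mulVec_mulVec, Matrix.mulVec_mulVec, e1, e2]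
  rw [← e3, Matrix.sub_mulVec, Matrix.one_mulVec, Matrix.mulVec_mulVec]
  abel

end DesignData

namespace DesignData

variable {L : ℕ} {Y U D G : Type*}
  [Fintype Y] [Fintype U] [Fintype D] [Fintype G]
  [DecidableEq Y] [DecidableEq U] [DecidableEq D] [DecidableEq G]
  {S : DesignData L Y U D G}

/-! ### Existence of the closed loop -/

/-- The hypothesis says that consecutive windows agree on their overlap, so they glue: take the
whole first window, then the last sample of each later one. -/
theorem exists_isParam_of_shift {x : ℕ → G → ℝ}
    (hx : ∀ k, S.F_wp *ᵥ x (k + 1) = S.F_pp *ᵥ x k) :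
    ∃ w : ℕ → Y ⊕ U ⊕ D → ℝ, ∀ k, S.IsParam w k (x k) := by
  refine ⟨fun t c => if h : t < L + 1 then (S.F *ᵥ x 0) (⟨t, h⟩, c)
    else (S.F_w *ᵥ x (t - L)) c, fun k => ?_⟩
  induction k with
  | zero =>
    intro p
    have := p.1.2
    simp only [zero_add, this, dite_true]
  | succ k ih =>
    rintro ⟨i, c⟩
    refine Fin.lastCases ?_ (fun j => ?_) i
    · have h1 : ¬ (k + 1 + L < L + 1) := by omega
      have h2 : k + 1 + L - L = k + 1 := by omega
      simp only [Fin.val_last, h1, dite_false, h2]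
      rfl
    · have h1 := congrFun (hx k) (j, c)
      have h2 := ih (j.succ, c)
      have h3 : k + (j.succ : ℕ) = k + 1 + (j.castSucc : ℕ) := by
        simp only [Fin.val_succ, Fin.val_castSucc]; omega
      rw [h3] at h2
      exact h1.trans h2

/-- A pathwise recursion on the pair of true parameterizer and posterior estimate. Any values of the
uncertainties are admissible because the input is free. -/
theorem Parameterizes.exists_closedLoop {B : Set (ℕ → Y ⊕ U ⊕ D → ℝ)} (h : S.Parameterizes B)
    {Ω : Type*} (P₀ W : Matrix G G ℝ) (Yg : Matrix U G ℝ) (Kd : Matrix U D ℝ) (m : ℕ → D → ℝ)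
    (Δd : ℕ → Ω → D → ℝ) (Δu : ℕ → Ω → U → ℝ) (n : ℕ → Ω → Y ⊕ U ⊕ D → ℝ)
    (g₀ ghat₀ : Ω → G → ℝ) :
    ∃ (w : ℕ → Ω → Y ⊕ U ⊕ D → ℝ) (gprior gpost : ℕ → Ω → G → ℝ),
      S.IsClosedLoop B P₀ W Yg Kd m Δd Δu n g₀ ghat₀ w gprior gpost := by
  let pri : ℕ → (G → ℝ) → G → ℝ := fun k a =>
    (S.Fp + S.Fz * Yg * W⁻¹) *ᵥ a + (S.Ff + S.Fz * Kd) *ᵥ m (k + 1)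
  let nxt : ℕ → Ω → (G → ℝ) × (G → ℝ) → G → ℝ := fun k ω z =>
    S.Ep *ᵥ z.1 + S.Ef *ᵥ (m (k + 1) + Δd (k + 1) ω) +
      S.Eu *ᵥ (S.F_u *ᵥ pri k z.2 + Δu (k + 1) ω)
  let st : Ω → ℕ → (G → ℝ) × (G → ℝ) := fun ω k =>
    Nat.rec (g₀ ω, ghat₀ ω) (fun k z => (nxt k ω z, pri k z.2 +
      S.gainAt P₀ k *ᵥ (S.F_w *ᵥ nxt k ω z + n (k + 1) ω - S.F_w *ᵥ pri k z.2))) k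
  have hst : ∀ ω k, (st ω (k + 1)).1 = nxt k ω (st ω k) := fun ω k => rfl
  choose w hw using fun ω => exists_isParam_of_shift (S := S) (x := fun k => (st ω k).1)
    (fun k => (h.exists_next_param _ _ _).1)
  have hlast : ∀ ω k, w ω (L + (k + 1)) = S.F_w *ᵥ nxt k ω (st ω k) := fun ω k => by
    rw [← hst, (hw ω (k + 1)).F_w, add_comm]
  -- The truncated `k - 1` only assigns a default prior estimate at time `0`, which no closed-loop
  -- equation mentions.
  refine ⟨fun t ω => w ω t, fun k ω => pri (k - 1) (st ω (k - 1)).2, fun k ω => (st ω k).2,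
    ?_, ?_, ?_, ?_, ?_, ?_, ?_⟩
  · exact fun ω => h.mem_of_params fun k => ⟨_, hw ω k⟩
  · intro ω p
    have := hw ω 0 p
    rw [zero_add] at this
    exact this.symm
  · rfl
  · exact fun k ω => rfl
  · intro k ω i
    rw [hlast]
    exact congrFun (h.exists_next_param (st ω k).1 _ _).2.2 i
  · intro k ω i
    rw [hlast]
    exact congrFun (h.exists_next_param (st ω k).1 _ _).2.1 i
  · intro k ω
    rw [hlast]
    rfl

end DesignData

/-! ### Quadratic forms of real matrices -/

section Quadratic

variable {ι κ : Type*} [Fintype ι] [Fintype κ]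

theorem Matrix.PosSemidef.quad_nonneg {A : Matrix ι ι ℝ} (hA : A.PosSemidef) (v : ι → ℝ) :
    0 ≤ v ⬝ᵥ A *ᵥ v := by
  simpa using hA.dotProduct_mulVec_nonneg v

theorem Matrix.PosSemidef.transpose_eq {A : Matrix ι ι ℝ} (hA : A.PosSemidef) : Aᵀ = A := by
  have := hA.isHermitian.eq
  rwa [conjTranspose_eq_transpose_of_trivial] at this

theorem Matrix.posSemidef_of_quad {A : Matrix ι ι ℝ} (hA : Aᵀ = A)
    (h : ∀ v, 0 ≤ v ⬝ᵥ A *ᵥ v) : A.PosSemidef := by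
  refine PosSemidef.of_dotProduct_mulVec_nonneg ?_ (by simpa using h)
  rwa [IsHermitian, conjTranspose_eq_transpose_of_trivial]

theorem Matrix.PosSemidef.conj {A : Matrix ι ι ℝ} (hA : A.PosSemidef) (C : Matrix κ ι ℝ) :
    (C * A * Cᵀ).PosSemidef := by
  simpa [conjTranspose_eq_transpose_of_trivial] using hA.mul_mul_conjTranspose_same C

theorem Matrix.quad_conj (A : Matrix ι ι ℝ) (C : Matrix κ ι ℝ) (v : κ → ℝ) :
    v ⬝ᵥ (C * A * Cᵀ) *ᵥ v = (Cᵀ *ᵥ v) ⬝ᵥ A *ᵥ (Cᵀ *ᵥ v) := by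
  rw [← Matrix.mulVec_mulVec, ← Matrix.mulVec_mulVec, Matrix.dotProduct_mulVec,
    ← Matrix.mulVec_transpose]

theorem Matrix.quad_add (A : Matrix ι ι ℝ) (hA : Aᵀ = A) (x y : ι → ℝ) :
    (x + y) ⬝ᵥ A *ᵥ (x + y) = x ⬝ᵥ A *ᵥ x + 2 * (x ⬝ᵥ A *ᵥ y) + y ⬝ᵥ A *ᵥ y := by
  have : y ⬝ᵥ A *ᵥ x = x ⬝ᵥ A *ᵥ y := by
    rw [Matrix.dotProduct_mulVec, ← Matrix.mulVec_transpose, hA, dotProduct_comm]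
  rw [Matrix.mulVec_add, add_dotProduct, dotProduct_add, dotProduct_add, this]
  ring

/-- Polarization. -/
theorem Matrix.entry_eq_quad [DecidableEq ι] {A : Matrix ι ι ℝ} (hA : Aᵀ = A) (i j : ι) :
    A i j = ((Pi.single i 1 + Pi.single j 1) ⬝ᵥ A *ᵥ (Pi.single i 1 + Pi.single j 1) -
      (Pi.single i 1 : ι → ℝ) ⬝ᵥ A *ᵥ (Pi.single i 1) -
      (Pi.single j 1 : ι → ℝ) ⬝ᵥ A *ᵥ (Pi.single j 1)) / 2 := by
  rw [Matrix.quad_add A hA]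
  have : (Pi.single i 1 : ι → ℝ) ⬝ᵥ A *ᵥ (Pi.single j 1) = A i j := by simp
  rw [this]
  ring

theorem Matrix.PosSemidef.cauchy_schwarz {A : Matrix ι ι ℝ} (hA : A.PosSemidef) (x y : ι → ℝ) :
    (x ⬝ᵥ A *ᵥ y) ^ 2 ≤ (x ⬝ᵥ A *ᵥ x) * (y ⬝ᵥ A *ᵥ y) := by
  have h : ∀ t : ℝ, 0 ≤ (y ⬝ᵥ A *ᵥ y) * (t * t) + (2 * (x ⬝ᵥ A *ᵥ y)) * t + x ⬝ᵥ A *ᵥ x := by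
    intro t
    have := hA.quad_nonneg (x + t • y)
    rw [Matrix.quad_add A hA.transpose_eq] at this
    simp only [Matrix.mulVec_smul, dotProduct_smul, smul_dotProduct, smul_eq_mul] at this
    linarith
  have := discrim_le_zero h
  rw [discrim] at this
  nlinarith

/-- Each coordinate of `x` is its `A`-inner product with a fixed vector `A⁻¹ e_j`, so Cauchy–Schwarz
bounds it by the quadratic form. -/
theorem Matrix.PosDef.tendsto_zero [DecidableEq ι] {A : Matrix ι ι ℝ} (hA : A.PosDef)
    {x : ℕ → ι → ℝ} (h : Tendsto (fun i => x i ⬝ᵥ A *ᵥ x i) atTop (𝓝 0)) :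
    Tendsto x atTop (𝓝 0) := by
  rw [tendsto_pi_nhds]
  intro j
  set y := A⁻¹ *ᵥ Pi.single j 1
  have hdet := (Matrix.isUnit_iff_isUnit_det _).1 hA.isUnit
  have key : ∀ i, x i j = x i ⬝ᵥ A *ᵥ y := fun i => by
    simp only [y]
    rw [Matrix.mulVec_mulVec, Matrix.mul_nonsing_inv _ hdet, Matrix.one_mulVec]
    simp
  have hsq : Tendsto (fun i => (x i j) ^ 2) atTop (𝓝 0) := by
    refine squeeze_zero (fun i => sq_nonneg _)
      (fun i => ?_) (by simpa using h.mul_const (y ⬝ᵥ A *ᵥ y))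
    rw [key]
    exact hA.posSemidef.cauchy_schwarz _ _
  have := hsq.sqrt
  simp only [Real.sqrt_sq_eq_abs, Real.sqrt_zero] at this
  exact (tendsto_zero_iff_abs_tendsto_zero _).2 this

theorem Matrix.tendsto_of_quad [DecidableEq ι] {A : ℕ → Matrix ι ι ℝ} {Z : Matrix ι ι ℝ}
    (hA : ∀ k, (A k)ᵀ = A k) (hZ : Zᵀ = Z)
    (h : ∀ v, Tendsto (fun k => v ⬝ᵥ A k *ᵥ v) atTop (𝓝 (v ⬝ᵥ Z *ᵥ v))) :
    Tendsto A atTop (𝓝 Z) := by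
  refine tendsto_pi_nhds.2 fun i => tendsto_pi_nhds.2 fun j => ?_
  simp only [fun k => Matrix.entry_eq_quad (hA k) i j, Matrix.entry_eq_quad hZ i j]
  exact (((h _).sub (h _)).sub (h _)).div_const 2

theorem Matrix.eq_of_quad [DecidableEq ι] {A Z : Matrix ι ι ℝ} (hA : Aᵀ = A) (hZ : Zᵀ = Z)
    (h : ∀ v, v ⬝ᵥ A *ᵥ v = v ⬝ᵥ Z *ᵥ v) : A = Z := by
  ext i j
  rw [Matrix.entry_eq_quad hA i j, Matrix.entry_eq_quad hZ i j, h, h, h]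

theorem Matrix.exists_tendsto_of_quad [DecidableEq ι] {A : ℕ → Matrix ι ι ℝ}
    (hA : ∀ k, (A k)ᵀ = A k)
    (h : ∀ v, ∃ l, Tendsto (fun k => v ⬝ᵥ A k *ᵥ v) atTop (𝓝 l)) :
    ∃ Z, Tendsto A atTop (𝓝 Z) := by
  choose q hq using h
  refine ⟨Matrix.of fun i j => (q (Pi.single i 1 + Pi.single j 1) - q (Pi.single i 1) -
    q (Pi.single j 1)) / 2, ?_⟩
  refine tendsto_pi_nhds.2 fun i => tendsto_pi_nhds.2 fun j => ?_
  simp only [fun k => Matrix.entry_eq_quad (hA k) i j]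
  exact (((hq _).sub (hq _)).sub (hq _)).div_const 2

theorem Matrix.tendsto_quad {A : ℕ → Matrix ι ι ℝ} {Z : Matrix ι ι ℝ}
    (h : Tendsto A atTop (𝓝 Z)) (v : ι → ℝ) :
    Tendsto (fun k => v ⬝ᵥ A k *ᵥ v) atTop (𝓝 (v ⬝ᵥ Z *ᵥ v)) := by
  have : Continuous fun A : Matrix ι ι ℝ => v ⬝ᵥ A *ᵥ v := by fun_prop
  exact (this.tendsto Z).comp h

end Quadratic

/-! ### The Riccati recursion -/

namespace DesignData

variable {L : ℕ} {Y U D G : Type*}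
  [Fintype Y] [Fintype U] [Fintype D] [Fintype G]
  [DecidableEq Y] [DecidableEq U] [DecidableEq D] [DecidableEq G]
  {S : DesignData L Y U D G}

/-- One step of the recursion for the posterior error covariance. -/
noncomputable def riccati (S : DesignData L Y U D G) (P : Matrix G G ℝ) : Matrix G G ℝ :=
  (1 - S.gain (S.priorCov P) * S.F_w) * S.priorCov P

/-- The posterior error covariance for an arbitrary gain `K` and prior error covariance `M`. -/
def joseph (S : DesignData L Y U D G) (K : Matrix G (Y ⊕ U ⊕ D) ℝ) (M : Matrix G G ℝ) :
    Matrix G G ℝ :=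
  (1 - K * S.F_w) * M * (1 - K * S.F_w)ᵀ + K * S.Sn * Kᵀ

/-- The covariance of the innovation. -/
def innov (S : DesignData L Y U D G) (M : Matrix G G ℝ) :
    Matrix (Y ⊕ U ⊕ D) (Y ⊕ U ⊕ D) ℝ :=
  S.F_w * M * S.F_wᵀ + S.Sn

theorem priorCov_eq (P : Matrix G G ℝ) : S.priorCov P = S.Ep * P * S.Epᵀ + S.calQ := by
  rw [priorCov, calQ, add_assoc]

/-- The three noise covariances are positive definite. -/
structure NoisePos (S : DesignData L Y U D G) : Prop where
  Sd : S.Sd.PosDef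
  Su : S.Su.PosDef
  Sn : S.Sn.PosDef

section

variable (hS : S.NoisePos)
include hS

theorem NoisePos.calQ : S.calQ.PosSemidef :=
  (hS.Sd.posSemidef.conj _).add (hS.Su.posSemidef.conj _)

theorem NoisePos.priorCov {P : Matrix G G ℝ} (hP : P.PosSemidef) :
    (S.priorCov P).PosSemidef := by
  rw [priorCov_eq]
  exact (hP.conj _).add hS.calQ

theorem NoisePos.innov {M : Matrix G G ℝ} (hM : M.PosSemidef) : (S.innov M).PosDef :=
  PosDef.posSemidef_add (hM.conj _) hS.Sn

theorem NoisePos.gain_mul_innov {M : Matrix G G ℝ} (hM : M.PosSemidef) :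
    S.gain M * S.innov M = M * S.F_wᵀ := by
  have hdet := (Matrix.isUnit_iff_isUnit_det _).1 (hS.innov hM).isUnit
  exact Matrix.nonsing_inv_mul_cancel_right _ _ hdet

theorem NoisePos.innov_mul_gain {M : Matrix G G ℝ} (hM : M.PosSemidef) :
    S.innov M * (S.gain M)ᵀ = S.F_w * M := by
  have := congrArg Matrix.transpose (hS.gain_mul_innov hM)
  simpa [Matrix.transpose_mul, (hS.innov hM).posSemidef.transpose_eq, hM.transpose_eq] using this

theorem NoisePos.gain_innov_gain {M : Matrix G G ℝ} (hM : M.PosSemidef) :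
    S.gain M * S.innov M * (S.gain M)ᵀ = S.gain M * S.F_w * M := by
  rw [Matrix.mul_assoc, hS.innov_mul_gain hM, Matrix.mul_assoc]

/-- Completing the square in the gain `K`; the minimum is at the filter gain. -/
theorem NoisePos.joseph_eq {M : Matrix G G ℝ} (hM : M.PosSemidef)
    (K : Matrix G (Y ⊕ U ⊕ D) ℝ) :
    S.joseph K M = (1 - S.gain M * S.F_w) * M +
      (K - S.gain M) * S.innov M * (K - S.gain M)ᵀ := by
  have e1 : S.joseph K M = M - K * (S.F_w * M) - (M * S.F_wᵀ) * Kᵀ + K * S.innov M * Kᵀ := by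
    simp only [joseph, DesignData.innov, Matrix.transpose_sub, Matrix.transpose_one,
      Matrix.transpose_mul, Matrix.sub_mul, Matrix.mul_sub, Matrix.one_mul, Matrix.mul_one,
      Matrix.mul_add, Matrix.add_mul, Matrix.mul_assoc]
    abel
  rw [e1, Matrix.sub_mul, Matrix.one_mul, ← hS.gain_innov_gain hM, ← hS.gain_mul_innov hM,
    ← hS.innov_mul_gain hM]
  simp only [Matrix.transpose_sub, Matrix.sub_mul, Matrix.mul_sub, Matrix.mul_assoc]
  abel

theorem NoisePos.joseph_gain {M : Matrix G G ℝ} (hM : M.PosSemidef) :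
    S.joseph (S.gain M) M = (1 - S.gain M * S.F_w) * M := by
  rw [hS.joseph_eq hM]; simp

theorem NoisePos.joseph_posSemidef {M : Matrix G G ℝ} (hM : M.PosSemidef)
    (K : Matrix G (Y ⊕ U ⊕ D) ℝ) : (S.joseph K M).PosSemidef :=
  (hM.conj _).add (hS.Sn.posSemidef.conj _)

theorem NoisePos.riccati_eq_joseph {P : Matrix G G ℝ} (hP : P.PosSemidef) :
    S.riccati P = S.joseph (S.gain (S.priorCov P)) (S.priorCov P) :=
  (hS.joseph_gain (hS.priorCov hP)).symm

theorem NoisePos.riccati {P : Matrix G G ℝ} (hP : P.PosSemidef) : (S.riccati P).PosSemidef := by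
  rw [hS.riccati_eq_joseph hP]
  exact hS.joseph_posSemidef (hS.priorCov hP) _

theorem NoisePos.postCov {P₀ : Matrix G G ℝ} (hP : P₀.PosSemidef) (k : ℕ) :
    (S.postCov P₀ k).PosSemidef := by
  induction k with
  | zero => exact hP
  | succ k ih => exact hS.riccati ih

theorem NoisePos.riccati_le_joseph {P : Matrix G G ℝ} (hP : P.PosSemidef)
    (K : Matrix G (Y ⊕ U ⊕ D) ℝ) :
    (S.joseph K (S.priorCov P) - S.riccati P).PosSemidef := by
  rw [hS.joseph_eq (hS.priorCov hP)]
  simp only [DesignData.riccati, add_sub_cancel_left]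
  exact (hS.innov (hS.priorCov hP)).posSemidef.conj _

omit hS in
theorem joseph_prior_sub (K : Matrix G (Y ⊕ U ⊕ D) ℝ) (P P' : Matrix G G ℝ) :
    S.joseph K (S.priorCov P') - S.joseph K (S.priorCov P) =
      ((1 - K * S.F_w) * S.Ep) * (P' - P) * ((1 - K * S.F_w) * S.Ep)ᵀ := by
  have h : S.priorCov P' - S.priorCov P = S.Ep * (P' - P) * S.Epᵀ := by
    rw [priorCov_eq, priorCov_eq, Matrix.mul_sub, Matrix.sub_mul]
    abel
  rw [joseph, joseph, add_sub_add_right_eq_sub, ← Matrix.sub_mul, ← Matrix.mul_sub, h,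
    Matrix.transpose_mul]
  simp only [Matrix.mul_assoc]

/-- The optimal gain for `P'` is suboptimal for `P`, and for a fixed gain the posterior covariance
is monotone in the prior one. -/
theorem NoisePos.riccati_mono {P P' : Matrix G G ℝ} (hP : P.PosSemidef) (hP' : P'.PosSemidef)
    (hle : (P' - P).PosSemidef) : (S.riccati P' - S.riccati P).PosSemidef := by
  have h1 := hS.riccati_le_joseph hP (S.gain (S.priorCov P'))
  have h2 := hle.conj ((1 - S.gain (S.priorCov P') * S.F_w) * S.Ep)
  rw [← joseph_prior_sub, ← hS.riccati_eq_joseph hP'] at h2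
  simpa using h2.add h1

theorem NoisePos.postCov_mono {P P' : Matrix G G ℝ} (hP : P.PosSemidef) (hP' : P'.PosSemidef)
    (hle : (P' - P).PosSemidef) (k : ℕ) : (S.postCov P' k - S.postCov P k).PosSemidef := by
  induction k with
  | zero => exact hle
  | succ k ih => exact hS.riccati_mono (hS.postCov hP k) (hS.postCov hP' k) ih

omit hS in
theorem postCov_fixed {P : Matrix G G ℝ} (hP : S.riccati P = P) (k : ℕ) :
    S.postCov P k = P := by
  induction k with
  | zero => rfl
  | succ k ih =>
    change S.riccati (S.postCov P k) = P
    rw [ih, hP]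

omit hS in
-- Moving the extra step to the start lets monotonicity in the initial covariance yield monotonicity
-- in time.
theorem postCov_succ' (P : Matrix G G ℝ) (k : ℕ) :
    S.postCov P (k + 1) = S.postCov (S.riccati P) k := by
  induction k with
  | zero => rfl
  | succ k ih =>
    change S.riccati (S.postCov P (k + 1)) = S.riccati (S.postCov (S.riccati P) k)
    rw [ih]

/-- The error dynamics of the filter with the gain of a constant prior covariance. -/
noncomputable def closedErr (S : DesignData L Y U D G) (P : Matrix G G ℝ) : Matrix G G ℝ :=
  (1 - S.gain (S.priorCov P) * S.F_w) * S.Ep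

/-- Using the steady-state gain of `P` throughout is suboptimal. Its covariance recursion is affine
with fixed point `P`, and deviations are propagated by `closedErr`. -/
theorem NoisePos.postCov_le {P : Matrix G G ℝ} (hP : P.PosSemidef) (hfix : S.riccati P = P)
    {P₀ : Matrix G G ℝ} (hP₀ : P₀.PosSemidef) (k : ℕ) :
    (P + S.closedErr P ^ k * (P₀ - P) * (S.closedErr P ^ k)ᵀ - S.postCov P₀ k).PosSemidef := by
  induction k with
  | zero => simpa [DesignData.postCov] using PosSemidef.zero
  | succ k ih =>
    have h1 := hS.riccati_le_joseph (hS.postCov hP₀ k) (S.gain (S.priorCov P))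
    have h2 := ih.conj (S.closedErr P)
    have h3 := joseph_prior_sub (S := S) (S.gain (S.priorCov P)) P (S.postCov P₀ k)
    rw [← hS.riccati_eq_joseph hP, hfix] at h3
    have h4 := h2.add h1
    convert h4 using 1
    change _ - S.riccati (S.postCov P₀ k) = _
    rw [sub_eq_iff_eq_add.1 h3, pow_succ']
    change _ = _ + (S.closedErr P * (S.postCov P₀ k - P) * (S.closedErr P)ᵀ + P -
      S.riccati (S.postCov P₀ k))
    simp only [Matrix.transpose_mul, Matrix.mul_sub, Matrix.sub_mul, Matrix.mul_add,
      Matrix.add_mul, Matrix.mul_assoc]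
    abel

/-- The fixed point equation as a Lyapunov equation of the error dynamics. -/
theorem NoisePos.fixed_eq {P : Matrix G G ℝ} (hP : P.PosSemidef) (hfix : S.riccati P = P)
    {C : Matrix G G ℝ} {K : Matrix G (Y ⊕ U ⊕ D) ℝ} (hK : K = S.gain (S.priorCov P))
    (hC : C = 1 - K * S.F_w) :
    P = (C * S.Ep) * P * (C * S.Ep)ᵀ + (C * S.Ef) * S.Sd * (C * S.Ef)ᵀ +
      (C * S.Eu) * S.Su * (C * S.Eu)ᵀ + K * S.Sn * Kᵀ := by
  conv_lhs => rw [← hfix, hS.riccati_eq_joseph hP, ← hK, joseph, ← hC, priorCov_eq,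
    DesignData.calQ]
  simp only [Matrix.transpose_mul, Matrix.mul_add, Matrix.add_mul, Matrix.mul_assoc, add_assoc]

omit hS in
theorem tendsto_dotProduct_zero {κ : Type*} [Fintype κ] (c : κ → ℝ) {z : ℕ → κ → ℝ}
    (hz : Tendsto z atTop (𝓝 0)) : Tendsto (fun k => c ⬝ᵥ z k) atTop (𝓝 0) := by
  have hc : Continuous fun y : κ → ℝ => c ⬝ᵥ y := by fun_prop
  simpa [Function.comp_def] using (hc.tendsto 0).comp hz

omit hS in
theorem dotProduct_transpose_mulVec {ι κ : Type*} [Fintype ι] [Fintype κ] (A : Matrix ι κ ℝ)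
    (c : κ → ℝ) (z : ι → ℝ) : c ⬝ᵥ (Aᵀ *ᵥ z) = (A *ᵥ c) ⬝ᵥ z := by
  rw [Matrix.dotProduct_mulVec, Matrix.vecMul_transpose]

omit hS in
/-- A sequence of covectors that asymptotically follows the adjoint dynamics and annihilates the
inputs tends to zero if every parameterizer can be steered to zero. -/
theorem tendsto_zero_of_adjoint
    (hnc : ∀ g : G → ℝ, ∃ (N : ℕ) (x : ℕ → G → ℝ) (d : ℕ → D → ℝ) (u : ℕ → U → ℝ),
      x 0 = g ∧ x N = 0 ∧ ∀ k, x (k + 1) = S.Ep *ᵥ x k + S.Ef *ᵥ d k + S.Eu *ᵥ u k)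
    {x r : ℕ → G → ℝ} (hsucc : ∀ k, x (k + 1) = S.Epᵀ *ᵥ r k)
    (hr : Tendsto (fun k => x k - r k) atTop (𝓝 0))
    (hEf : Tendsto (fun k => S.Efᵀ *ᵥ r k) atTop (𝓝 0))
    (hEu : Tendsto (fun k => S.Euᵀ *ᵥ r k) atTop (𝓝 0)) :
    Tendsto x atTop (𝓝 0) := by
  -- Duality: pairing `g` with the next covector is, up to vanishing terms, pairing any successor of
  -- `g` with the present covector.
  have hback : ∀ (g : G → ℝ) (d : D → ℝ) (u : U → ℝ),
      Tendsto (fun k => (S.Ep *ᵥ g + S.Ef *ᵥ d + S.Eu *ᵥ u) ⬝ᵥ x k) atTop (𝓝 0) →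
      Tendsto (fun k => g ⬝ᵥ x k) atTop (𝓝 0) := by
    intro g d u hg
    rw [← tendsto_add_atTop_iff_nat 1]
    have h1 : ∀ k, g ⬝ᵥ x (k + 1) = (S.Ep *ᵥ g + S.Ef *ᵥ d + S.Eu *ᵥ u) ⬝ᵥ x k -
        (S.Ep *ᵥ g + S.Ef *ᵥ d + S.Eu *ᵥ u) ⬝ᵥ (x k - r k) -
        d ⬝ᵥ (S.Efᵀ *ᵥ r k) - u ⬝ᵥ (S.Euᵀ *ᵥ r k) := by
      intro k
      rw [hsucc, dotProduct_transpose_mulVec, dotProduct_transpose_mulVec,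
        dotProduct_transpose_mulVec, dotProduct_sub, add_dotProduct, add_dotProduct,
        add_dotProduct, add_dotProduct]
      ring
    refine Tendsto.congr (fun k => (h1 k).symm) ?_
    have h2 := ((hg.sub (tendsto_dotProduct_zero (S.Ep *ᵥ g + S.Ef *ᵥ d + S.Eu *ᵥ u) hr)).sub
      (tendsto_dotProduct_zero d hEf)).sub (tendsto_dotProduct_zero u hEu)
    rw [sub_zero, sub_zero, sub_zero] at h2
    exact h2
  have hall : ∀ g : G → ℝ, Tendsto (fun k => g ⬝ᵥ x k) atTop (𝓝 0) := by
    intro g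
    obtain ⟨N, z, d, u, rfl, hN, hz⟩ := hnc g
    -- Backward induction along the steering sequence, starting from its endpoint `z N = 0`.
    have : ∀ j ≤ N, Tendsto (fun k => z (N - j) ⬝ᵥ x k) atTop (𝓝 0) := by
      intro j
      induction j with
      | zero => intro _; simp [hN]
      | succ j ih =>
        intro hj
        have h1 := ih (by omega)
        obtain ⟨i, hi⟩ : ∃ i, N - j = i + 1 := ⟨N - j - 1, by omega⟩
        rw [hi, hz] at h1
        have h2 : N - (j + 1) = i := by omega
        rw [h2]
        exact hback _ _ _ h1
    simpa using this N le_rfl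
  rw [tendsto_pi_nhds]
  intro i
  simpa using hall (Pi.single i 1)

/-- The error dynamics of a steady-state filter are stable if every parameterizer can be steered
to zero. -/
theorem NoisePos.closedErr_stable
    (hnc : ∀ g : G → ℝ, ∃ (N : ℕ) (x : ℕ → G → ℝ) (d : ℕ → D → ℝ) (u : ℕ → U → ℝ),
      x 0 = g ∧ x N = 0 ∧ ∀ k, x (k + 1) = S.Ep *ᵥ x k + S.Ef *ᵥ d k + S.Eu *ᵥ u k)
    {P : Matrix G G ℝ} (hP : P.PosSemidef) (hfix : S.riccati P = P) (v : G → ℝ) :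
    Tendsto (fun k => (S.closedErr P ^ k)ᵀ *ᵥ v) atTop (𝓝 0) := by
  obtain ⟨K, hK⟩ : ∃ K, K = S.gain (S.priorCov P) := ⟨_, rfl⟩
  obtain ⟨C, hC⟩ : ∃ C, C = 1 - K * S.F_w := ⟨_, rfl⟩
  have hAc : S.closedErr P = C * S.Ep := by rw [closedErr, hC, hK]
  have hdec := hS.fixed_eq hP hfix hK hC
  obtain ⟨x, hx⟩ : ∃ x : ℕ → G → ℝ, x = fun k => (S.closedErr P ^ k)ᵀ *ᵥ v := ⟨_, rfl⟩
  have hsucc : ∀ k, x (k + 1) = S.Epᵀ *ᵥ (Cᵀ *ᵥ x k) := fun k => by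
    simp only [hx, pow_succ, Matrix.mulVec_mulVec, hAc, Matrix.transpose_mul, Matrix.mul_assoc]
  -- `P` is a Lyapunov function for the adjoint error dynamics. Its decrements tend to zero, so each
  -- of these three nonnegative terms does too.
  have hstep : ∀ k, x k ⬝ᵥ P *ᵥ x k - x (k + 1) ⬝ᵥ P *ᵥ x (k + 1) =
      (S.Efᵀ *ᵥ (Cᵀ *ᵥ x k)) ⬝ᵥ S.Sd *ᵥ (S.Efᵀ *ᵥ (Cᵀ *ᵥ x k)) +
      (S.Euᵀ *ᵥ (Cᵀ *ᵥ x k)) ⬝ᵥ S.Su *ᵥ (S.Euᵀ *ᵥ (Cᵀ *ᵥ x k)) +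
      (Kᵀ *ᵥ x k) ⬝ᵥ S.Sn *ᵥ (Kᵀ *ᵥ x k) := by
    intro k
    rw [hsucc]
    have h1 := congrArg (fun A : Matrix G G ℝ => x k ⬝ᵥ A *ᵥ x k) hdec
    simp only [Matrix.add_mulVec, dotProduct_add, Matrix.quad_conj] at h1
    simp only [Matrix.transpose_mul, ← Matrix.mulVec_mulVec] at h1
    linarith
  rw [← hx]
  have h1 := fun k => hS.Sd.posSemidef.quad_nonneg (S.Efᵀ *ᵥ (Cᵀ *ᵥ x k))
  have h2 := fun k => hS.Su.posSemidef.quad_nonneg (S.Euᵀ *ᵥ (Cᵀ *ᵥ x k))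
  have h3 := fun k => hS.Sn.posSemidef.quad_nonneg (Kᵀ *ᵥ x k)
  have hanti : Antitone fun k => x k ⬝ᵥ P *ᵥ x k := antitone_nat_of_succ_le fun k => by
    linarith [hstep k, h1 k, h2 k, h3 k]
  have hlim := tendsto_atTop_ciInf hanti ⟨0, by rintro _ ⟨k, rfl⟩; exact hP.quad_nonneg _⟩
  have hdiff : Tendsto (fun k => x k ⬝ᵥ P *ᵥ x k - x (k + 1) ⬝ᵥ P *ᵥ x (k + 1)) atTop (𝓝 0) := by
    simpa using hlim.sub ((tendsto_add_atTop_iff_nat 1).2 hlim)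
  have hEf := hS.Sd.tendsto_zero (squeeze_zero h1
    (fun k => by linarith [hstep k, h2 k, h3 k]) hdiff)
  have hEu := hS.Su.tendsto_zero (squeeze_zero h2
    (fun k => by linarith [hstep k, h1 k, h3 k]) hdiff)
  have hKx := hS.Sn.tendsto_zero (squeeze_zero h3
    (fun k => by linarith [hstep k, h1 k, h2 k]) hdiff)
  refine tendsto_zero_of_adjoint hnc hsucc ?_ hEf hEu
  -- As `Kᵀ x` vanishes in the limit, the orbit asymptotically follows the open-loop adjoint
  -- dynamics.
  have h4 : ∀ k, x k - Cᵀ *ᵥ x k = S.F_wᵀ *ᵥ (Kᵀ *ᵥ x k) := fun k => by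
    rw [hC, Matrix.transpose_sub, Matrix.transpose_one, Matrix.sub_mulVec, Matrix.one_mulVec,
      Matrix.transpose_mul, Matrix.mulVec_mulVec]
    abel
  simp only [h4]
  have hc : Continuous fun y : Y ⊕ U ⊕ D → ℝ => S.F_wᵀ *ᵥ y := by fun_prop
  simpa [Function.comp_def] using (hc.tendsto 0).comp hKx

omit hS in
theorem quad_le_of_sub {A C : Matrix G G ℝ} (h : (C - A).PosSemidef) (v : G → ℝ) :
    v ⬝ᵥ A *ᵥ v ≤ v ⬝ᵥ C *ᵥ v := by
  have := h.quad_nonneg v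
  rw [Matrix.sub_mulVec, dotProduct_sub] at this
  linarith

/-- Positive definite measurement noise keeps the innovation covariance invertible at the limit, so
inversion is continuous there. -/
theorem NoisePos.tendsto_riccati {A : ℕ → Matrix G G ℝ} {Z : Matrix G G ℝ}
    (hZ : Z.PosSemidef) (h : Tendsto A atTop (𝓝 Z)) :
    Tendsto (fun k => S.riccati (A k)) atTop (𝓝 (S.riccati Z)) := by
  have hcp : Continuous fun P : Matrix G G ℝ => S.priorCov P := by
    unfold DesignData.priorCov
    fun_prop
  have hp : Tendsto (fun k => S.priorCov (A k)) atTop (𝓝 (S.priorCov Z)) :=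
    (hcp.tendsto Z).comp h
  have hci : Continuous fun M : Matrix G G ℝ => S.innov M := by
    unfold DesignData.innov
    fun_prop
  have hi : Tendsto (fun k => S.innov (S.priorCov (A k))) atTop (𝓝 (S.innov (S.priorCov Z))) :=
    (hci.tendsto _).comp hp
  have hdet : (S.innov (S.priorCov Z)).det ≠ 0 :=
    ((Matrix.isUnit_iff_isUnit_det _).1 (hS.innov (hS.priorCov hZ)).isUnit).ne_zero
  have hinv : Tendsto (fun k => (S.innov (S.priorCov (A k)))⁻¹) atTop
      (𝓝 (S.innov (S.priorCov Z))⁻¹) := by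
    simp only [Matrix.inv_def, Ring.inverse_eq_inv']
    have h1 : Continuous fun M : Matrix (Y ⊕ U ⊕ D) (Y ⊕ U ⊕ D) ℝ => M.det :=
      continuous_id.matrix_det
    have h2 : Continuous fun M : Matrix (Y ⊕ U ⊕ D) (Y ⊕ U ⊕ D) ℝ => M.adjugate :=
      continuous_id.matrix_adjugate
    exact (((h1.tendsto _).comp hi).inv₀ hdet).smul ((h2.tendsto _).comp hi)
  have hg : Tendsto (fun k => S.gain (S.priorCov (A k))) atTop (𝓝 (S.gain (S.priorCov Z))) := by
    have hc : Continuous fun z : Matrix G G ℝ × Matrix (Y ⊕ U ⊕ D) (Y ⊕ U ⊕ D) ℝ =>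
        z.1 * S.F_wᵀ * z.2 := by fun_prop
    have := (hc.tendsto (S.priorCov Z, (S.innov (S.priorCov Z))⁻¹)).comp (hp.prodMk_nhds hinv)
    exact this
  have hc : Continuous fun z : Matrix G G ℝ × Matrix G (Y ⊕ U ⊕ D) ℝ =>
      (1 - z.2 * S.F_w) * z.1 := by fun_prop
  have := (hc.tendsto (S.priorCov Z, S.gain (S.priorCov Z))).comp (hp.prodMk_nhds hg)
  exact this

/-- The posterior error covariances converge to any positive semidefinite fixed point of the
Riccati recursion. -/
theorem NoisePos.tendsto_postCov
    (hnc : ∀ g : G → ℝ, ∃ (N : ℕ) (x : ℕ → G → ℝ) (d : ℕ → D → ℝ) (u : ℕ → U → ℝ),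
      x 0 = g ∧ x N = 0 ∧ ∀ k, x (k + 1) = S.Ep *ᵥ x k + S.Ef *ᵥ d k + S.Eu *ᵥ u k)
    {P : Matrix G G ℝ} (hP : P.PosSemidef) (hfix : S.riccati P = P)
    {P₀ : Matrix G G ℝ} (hP₀ : P₀.PosSemidef) :
    Tendsto (S.postCov P₀) atTop (𝓝 P) := by
  have hup : ∀ {Z : Matrix G G ℝ}, Z.PosSemidef → S.riccati Z = Z →
      ∀ {P₀ : Matrix G G ℝ}, P₀.PosSemidef → ∀ v : G → ℝ, ∃ ε : ℕ → ℝ,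
      Tendsto ε atTop (𝓝 (v ⬝ᵥ Z *ᵥ v)) ∧ ∀ k, v ⬝ᵥ S.postCov P₀ k *ᵥ v ≤ ε k := by
    intro Z hZ hZfix P₀ hP₀ v
    refine ⟨fun k => v ⬝ᵥ (Z + S.closedErr Z ^ k * (P₀ - Z) * (S.closedErr Z ^ k)ᵀ) *ᵥ v, ?_,
      fun k => quad_le_of_sub (hS.postCov_le hZ hZfix hP₀ k) v⟩
    simp only [Matrix.add_mulVec, dotProduct_add, Matrix.quad_conj]
    have hc : Continuous fun y : G → ℝ => y ⬝ᵥ (P₀ - Z) *ᵥ y := by fun_prop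
    have := (hc.tendsto 0).comp (hS.closedErr_stable hnc hZ hZfix v)
    simpa [Function.comp_def] using this.const_add (v ⬝ᵥ Z *ᵥ v)
  -- Start the recursion at the fixed point `Z'`, where it stays, and compare with the upper bound
  -- tending to `Z`. By symmetry, fixed points are unique.
  have hle : ∀ {Z Z' : Matrix G G ℝ}, Z.PosSemidef → S.riccati Z = Z → Z'.PosSemidef →
      S.riccati Z' = Z' → ∀ v : G → ℝ, v ⬝ᵥ Z' *ᵥ v ≤ v ⬝ᵥ Z *ᵥ v := by
    intro Z Z' hZ hZf hZ' hZf' v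
    obtain ⟨ε, hε, hεle⟩ := hup hZ hZf hZ' v
    refine ge_of_tendsto' hε fun k => ?_
    have := hεle k
    rwa [postCov_fixed hZf'] at this
  have hz := PosSemidef.zero (n := G) (R := ℝ)
  -- The recursion from `0` is increasing and bounded by `P`. Its limit is a fixed point, hence `P`,
  -- and it serves as lower bound for every other start.
  have hmono : ∀ v : G → ℝ, Monotone fun k => v ⬝ᵥ S.postCov 0 k *ᵥ v := by
    intro v
    refine monotone_nat_of_le_succ fun k => ?_
    rw [postCov_succ']
    refine quad_le_of_sub (hS.postCov_mono hz (hS.riccati hz) ?_ k) v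
    simpa using hS.riccati hz
  have hbdd : ∀ (v : G → ℝ) k, v ⬝ᵥ S.postCov 0 k *ᵥ v ≤ v ⬝ᵥ P *ᵥ v := by
    intro v k
    have := hS.postCov_mono hz hP (by simpa using hP) k
    rw [postCov_fixed hfix] at this
    exact quad_le_of_sub this v
  obtain ⟨Z, hZ⟩ := Matrix.exists_tendsto_of_quad
    (A := S.postCov 0) (fun k => (hS.postCov hz k).transpose_eq)
    (fun v => ⟨_, tendsto_atTop_ciSup (hmono v) ⟨_, by rintro _ ⟨k, rfl⟩; exact hbdd v k⟩⟩)
  have hZp : Z.PosSemidef := by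
    refine Matrix.posSemidef_of_quad ?_ fun v =>
      ge_of_tendsto' (Matrix.tendsto_quad hZ v) fun k => (hS.postCov hz k).quad_nonneg v
    have hct : Continuous fun A : Matrix G G ℝ => Aᵀ := by fun_prop
    refine tendsto_nhds_unique ((hct.tendsto Z).comp hZ) (hZ.congr fun k => ?_)
    exact (hS.postCov hz k).transpose_eq.symm
  have hZf : S.riccati Z = Z :=
    tendsto_nhds_unique (hS.tendsto_riccati hZp hZ) ((tendsto_add_atTop_iff_nat 1).2 hZ)
  have hZP : Z = P := Matrix.eq_of_quad hZp.transpose_eq hP.transpose_eq fun v =>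
    le_antisymm (hle hP hfix hZp hZf v) (hle hZp hZf hP hfix v)
  subst hZP
  refine Matrix.tendsto_of_quad (fun k => (hS.postCov hP₀ k).transpose_eq) hP.transpose_eq
    fun v => ?_
  obtain ⟨ε, hε, hεle⟩ := hup hP hfix hP₀ v
  refine tendsto_of_tendsto_of_tendsto_of_le_of_le (Matrix.tendsto_quad hZ v) hε (fun k => ?_) hεle
  exact quad_le_of_sub (hS.postCov_mono hz hP₀ (by simpa using hP₀) k) v

/-- The correction term of the algebraic Riccati equation is the covariance reduction achieved by
one measurement, which links that equation to fixed points of `riccati`. -/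
theorem calN_eq {P : Matrix G G ℝ} (hP : P.PosSemidef) :
    S.calN P = S.gain (S.priorCov P) * S.F_w * S.priorCov P := by
  have e1 : S.calA * P * S.Epᵀ + S.calT = S.F_w * S.priorCov P := by
    simp only [calA, calT, DesignData.priorCov, Matrix.mul_add, Matrix.mul_assoc, add_assoc]
  have e2 : S.calA * P * S.calAᵀ + S.calR = S.innov (S.priorCov P) := by
    simp only [calA, calR, DesignData.innov, DesignData.priorCov, Matrix.mul_add, Matrix.add_mul,
      Matrix.transpose_mul, Matrix.mul_assoc, add_assoc]
  rw [calN, e1, e2, Matrix.transpose_mul, (hS.priorCov hP).transpose_eq]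
  simp only [DesignData.gain, DesignData.innov, Matrix.mul_assoc]

theorem NoisePos.calN {P : Matrix G G ℝ} (hP : P.PosSemidef) : (S.calN P).PosSemidef := by
  rw [calN_eq hS hP, ← hS.gain_innov_gain (hS.priorCov hP)]
  exact (hS.innov (hS.priorCov hP)).posSemidef.conj _

theorem NoisePos.riccati_eq_sub {P : Matrix G G ℝ} (hP : P.PosSemidef) :
    S.riccati P = S.priorCov P - S.calN P := by
  rw [calN_eq hS hP, DesignData.riccati, Matrix.sub_mul, Matrix.one_mul]

theorem NoisePos.riccati_of_solvesARE {P : Matrix G G ℝ} (hP : S.SolvesARE P) :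
    S.riccati P = P := by
  rw [hS.riccati_eq_sub hP.1]
  conv_rhs => rw [hP.2]
  rw [priorCov_eq]
  abel

end

end DesignData

/-! ### Consequences of the matrix inequalities -/

section

variable {ι κ : Type*} [Fintype ι] [Fintype κ]

theorem Matrix.quad_fromBlocks (A : Matrix ι ι ℝ) (C : Matrix κ ι ℝ) (E : Matrix κ κ ℝ)
    (p : ι → ℝ) (q : κ → ℝ) :
    Sum.elim p q ⬝ᵥ Matrix.fromBlocks A Cᵀ C E *ᵥ Sum.elim p q =
      p ⬝ᵥ A *ᵥ p + 2 * (q ⬝ᵥ C *ᵥ p) + q ⬝ᵥ E *ᵥ q := by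
  rw [Matrix.fromBlocks_mulVec, sumElim_dotProduct_sumElim]
  simp only [Sum.elim_comp_inl, Sum.elim_comp_inr, dotProduct_add]
  have : p ⬝ᵥ Cᵀ *ᵥ q = q ⬝ᵥ C *ᵥ p := by
    rw [Matrix.dotProduct_mulVec, Matrix.vecMul_transpose, dotProduct_comm]
  rw [this]
  ring

theorem Matrix.trace_eq_sum_quad [DecidableEq ι] (A : Matrix ι ι ℝ) :
    A.trace = ∑ i, (Pi.single i 1 : ι → ℝ) ⬝ᵥ A *ᵥ Pi.single i 1 := by
  simp [Matrix.trace]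

theorem msqrt_mul_self [DecidableEq ι] {A : Matrix ι ι ℝ} (hA : A.PosSemidef) :
    msqrt A * msqrt A = A := by
  have hc : ∀ f : ℝ → ℝ, ContinuousOn f (spectrum ℝ A) := fun f =>
    (Matrix.finite_real_spectrum).continuousOn f
  have hsa : IsSelfAdjoint A := hA.isHermitian
  rw [msqrt, ← cfc_mul _ _ A (hc _) (hc _)]
  conv_rhs => rw [← cfc_id' ℝ A]
  refine cfc_congr fun x hx => ?_
  rw [hA.isHermitian.spectrum_real_eq_range_eigenvalues] at hx
  obtain ⟨i, rfl⟩ := hx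
  exact Real.mul_self_sqrt (hA.eigenvalues_nonneg i)

theorem msqrt_transpose [DecidableEq ι] (A : Matrix ι ι ℝ) : (msqrt A)ᵀ = msqrt A := by
  have h : IsSelfAdjoint (msqrt A) := cfc_predicate _ _
  rwa [isSelfAdjoint_iff, star_eq_conjTranspose, conjTranspose_eq_transpose_of_trivial] at h

end

namespace DesignData

variable {L : ℕ} {Y U D G : Type*}
  [Fintype Y] [Fintype U] [Fintype D] [Fintype G]
  [DecidableEq Y] [DecidableEq U] [DecidableEq D] [DecidableEq G]
  {S : DesignData L Y U D G} {P : Matrix G G ℝ} {γ₁ γ₂ : ℝ}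
  {W X : Matrix G G ℝ} {Yg : Matrix U G ℝ} {Kd : Matrix U D ℝ}

/-- A Schur complement, carried out by evaluating the block form at a single vector. -/
theorem LMIs.dissipation (h : S.LMIs P γ₁ γ₂ W X Yg Kd) (x : G → ℝ) (δ : D → ℝ) :
    (S.F_y *ᵥ x) ⬝ᵥ (S.F_y *ᵥ x) +
      ((S.Fp + S.Fz * Yg * W⁻¹) *ᵥ x + (S.Ff + S.Fz * Kd) *ᵥ δ) ⬝ᵥ
        W⁻¹ *ᵥ ((S.Fp + S.Fz * Yg * W⁻¹) *ᵥ x + (S.Ff + S.Fz * Kd) *ᵥ δ) ≤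
    x ⬝ᵥ W⁻¹ *ᵥ x + γ₁ ^ 2 * (δ ⬝ᵥ δ) := by
  have hdet := (Matrix.isUnit_iff_isUnit_det _).1 h.pos.isUnit
  have hWi : ∀ v : G → ℝ, W *ᵥ (W⁻¹ *ᵥ v) = v := fun v => by
    rw [Matrix.mulVec_mulVec, Matrix.mul_nonsing_inv _ hdet, Matrix.one_mulVec]
  set z := (S.Fp + S.Fz * Yg * W⁻¹) *ᵥ x + (S.Ff + S.Fz * Kd) *ᵥ δ with hz
  have hlow : S.dissLower W Yg Kd *ᵥ Sum.elim (W⁻¹ *ᵥ x) δ = Sum.elim (S.F_y *ᵥ x) z := by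
    rw [dissLower, Matrix.fromBlocks_mulVec]
    simp only [Sum.elim_comp_inl, Sum.elim_comp_inr, Matrix.zero_mulVec, add_zero]
    congr 1
    · rw [← Matrix.mulVec_mulVec, hWi]
    · rw [hz, Matrix.mulVec_mulVec, Matrix.add_mul, Matrix.mul_nonsing_inv_cancel_right _ _ hdet]
  -- The last two blocks minimize the quadratic form for the given first two; `W⁻¹ x` undoes the
  -- substitution `Y_g = H W` of the feedback gain.
  have h0 := h.diss.quad_nonneg (Sum.elim (Sum.elim (W⁻¹ *ᵥ x) δ)
    (Sum.elim (-(S.F_y *ᵥ x)) (-(W⁻¹ *ᵥ z))))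
  rw [dissBlock, Matrix.quad_fromBlocks, hlow] at h0
  simp only [Matrix.fromBlocks_mulVec, sumElim_dotProduct_sumElim, Sum.elim_comp_inl,
    Sum.elim_comp_inr, Matrix.zero_mulVec, neg_zero, add_zero, zero_add, hWi, Matrix.one_mulVec,
    Matrix.smul_mulVec, Matrix.mulVec_neg, neg_dotProduct, dotProduct_neg, dotProduct_smul,
    smul_eq_mul, neg_neg] at h0
  rw [dotProduct_comm (W⁻¹ *ᵥ x) x, dotProduct_comm (W⁻¹ *ᵥ z) z] at h0
  linarith

/-- A Schur complement bounds `X` below by `N^{1/2} W⁻¹ N^{1/2} + P^{1/2} (Π_y F)ᵀ Π_y F P^{1/2}`;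
take traces and use their cyclicity. -/
theorem LMIs.trace_le (hS : S.NoisePos) (hP : P.PosSemidef) (h : S.LMIs P γ₁ γ₂ W X Yg Kd) :
    (W⁻¹ * S.calN P).trace + (S.F_y * P * S.F_yᵀ).trace ≤ γ₂ ^ 2 * S.Sd.trace := by
  have hdet := (Matrix.isUnit_iff_isUnit_det _).1 h.pos.isUnit
  have hWi : ∀ v : G → ℝ, W *ᵥ (W⁻¹ *ᵥ v) = v := fun v => by
    rw [Matrix.mulVec_mulVec, Matrix.mul_nonsing_inv _ hdet, Matrix.one_mulVec]
  set N := msqrt (S.calN P) with hN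
  set C := S.F_y * msqrt P with hC
  have hNN : N * N = S.calN P := msqrt_mul_self (hS.calN hP)
  have hNT : Nᵀ = N := msqrt_transpose _
  have hquad : ∀ v : G → ℝ,
      0 ≤ v ⬝ᵥ X *ᵥ v - v ⬝ᵥ (N * W⁻¹ * Nᵀ) *ᵥ v - v ⬝ᵥ (Cᵀ * C) *ᵥ v := by
    intro v
    have h0 := h.offset.quad_nonneg
      (Sum.elim (Sum.elim v (-(W⁻¹ *ᵥ (N *ᵥ v)))) (-(C *ᵥ v)))
    rw [offsetBlock, Matrix.quad_fromBlocks, Matrix.quad_fromBlocks, Matrix.fromCols_mulVec] at h0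
    simp only [Sum.elim_comp_inl, Sum.elim_comp_inr, Matrix.zero_mulVec, add_zero, hWi,
      Matrix.one_mulVec, Matrix.mulVec_neg, neg_dotProduct, dotProduct_neg, neg_neg, neg_zero,
      ← hN, ← hC] at h0
    rw [dotProduct_comm (W⁻¹ *ᵥ _) _] at h0
    have h1 : v ⬝ᵥ (N * W⁻¹ * Nᵀ) *ᵥ v = (N *ᵥ v) ⬝ᵥ W⁻¹ *ᵥ (N *ᵥ v) := by
      rw [Matrix.quad_conj, hNT]
    have h2 : v ⬝ᵥ (Cᵀ * C) *ᵥ v = (C *ᵥ v) ⬝ᵥ (C *ᵥ v) := by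
      rw [← Matrix.mulVec_mulVec, Matrix.dotProduct_mulVec, Matrix.vecMul_transpose]
    rw [h1, h2]
    linarith
  have htr := Finset.sum_nonneg fun i (_ : i ∈ Finset.univ) => hquad (Pi.single i 1)
  rw [Finset.sum_sub_distrib, Finset.sum_sub_distrib, ← Matrix.trace_eq_sum_quad,
    ← Matrix.trace_eq_sum_quad, ← Matrix.trace_eq_sum_quad] at htr
  have e1 : (N * W⁻¹ * Nᵀ).trace = (W⁻¹ * S.calN P).trace := by
    rw [hNT, Matrix.trace_mul_comm, ← Matrix.mul_assoc, hNN, Matrix.trace_mul_comm]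
  have e2 : (Cᵀ * C).trace = (S.F_y * P * S.F_yᵀ).trace := by
    rw [Matrix.trace_mul_comm, hC, Matrix.transpose_mul, msqrt_transpose, Matrix.mul_assoc,
      ← Matrix.mul_assoc (msqrt P), msqrt_mul_self hP, Matrix.mul_assoc]
  rw [e1, e2] at htr
  have := h.offset_trace
  linarith

end DesignData

/-! ### Second moments of random vectors -/

section SecondMoment

variable {Ω : Type*} [MeasurableSpace Ω] {μ : Measure Ω}
  {ι κ ν : Type*} [Fintype ι] [Fintype κ] [Fintype ν]

/-- A random vector with square integrable components. -/
def SqInt (μ : Measure Ω) (f : Ω → ι → ℝ) : Prop :=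
  ∀ i, MemLp (fun ω => f ω i) 2 μ

/-- The matrix of mixed second moments of two random vectors. -/
noncomputable def secondMoment (μ : Measure Ω) (f : Ω → ι → ℝ) (h : Ω → κ → ℝ) :
    Matrix ι κ ℝ :=
  Matrix.of fun i j => ∫ ω, f ω i * h ω j ∂μ

theorem SqInt.add {f h : Ω → ι → ℝ} (hf : SqInt μ f) (hh : SqInt μ h) : SqInt μ (f + h) :=
  fun i => (hf i).add (hh i)

theorem SqInt.sub {f h : Ω → ι → ℝ} (hf : SqInt μ f) (hh : SqInt μ h) : SqInt μ (f - h) :=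
  fun i => (hf i).sub (hh i)

theorem SqInt.mulVec {f : Ω → ι → ℝ} (hf : SqInt μ f) (A : Matrix κ ι ℝ) :
    SqInt μ (fun ω => A *ᵥ f ω) := fun i => by
  simp only [Matrix.mulVec, dotProduct]
  exact memLp_finsetSum _ fun j _ => (hf j).const_mul _

theorem SqInt.const [IsFiniteMeasure μ] (c : ι → ℝ) : SqInt μ (fun _ => c) :=
  fun _ => memLp_const _

theorem SqInt.integrable_mul {f : Ω → ι → ℝ} {h : Ω → κ → ℝ} (hf : SqInt μ f)
    (hh : SqInt μ h) (i : ι) (j : κ) : Integrable (fun ω => f ω i * h ω j) μ :=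
  (hf i).integrable_mul (hh j)

theorem secondMoment_transpose (f : Ω → ι → ℝ) (h : Ω → κ → ℝ) :
    (secondMoment μ f h)ᵀ = secondMoment μ h f := by
  ext i j
  simp [secondMoment, mul_comm]

theorem secondMoment_eq_zero_symm {f : Ω → ι → ℝ} {h : Ω → κ → ℝ}
    (hz : secondMoment μ f h = 0) : secondMoment μ h f = 0 := by
  rw [← secondMoment_transpose, hz, Matrix.transpose_zero]

theorem secondMoment_add_left {f f' : Ω → ι → ℝ} {h : Ω → κ → ℝ} (hf : SqInt μ f)
    (hf' : SqInt μ f') (hh : SqInt μ h) :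
    secondMoment μ (f + f') h = secondMoment μ f h + secondMoment μ f' h := by
  ext i j
  simp only [secondMoment, Matrix.of_apply, Matrix.add_apply, Pi.add_apply, add_mul]
  exact integral_add (hf.integrable_mul hh i j) (hf'.integrable_mul hh i j)

theorem secondMoment_sub_left {f f' : Ω → ι → ℝ} {h : Ω → κ → ℝ} (hf : SqInt μ f)
    (hf' : SqInt μ f') (hh : SqInt μ h) :
    secondMoment μ (f - f') h = secondMoment μ f h - secondMoment μ f' h := by
  ext i j
  simp only [secondMoment, Matrix.of_apply, Matrix.sub_apply, Pi.sub_apply, sub_mul]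
  exact integral_sub (hf.integrable_mul hh i j) (hf'.integrable_mul hh i j)

theorem secondMoment_mulVec_left {f : Ω → ι → ℝ} {h : Ω → κ → ℝ} (hf : SqInt μ f)
    (hh : SqInt μ h) (A : Matrix ν ι ℝ) :
    secondMoment μ (fun ω => A *ᵥ f ω) h = A * secondMoment μ f h := by
  ext i j
  simp only [secondMoment, Matrix.of_apply, Matrix.mul_apply, Matrix.mulVec, dotProduct,
    Finset.sum_mul, mul_assoc]
  rw [integral_finsetSum _ fun l _ => (hf.integrable_mul hh l j).const_mul _]
  simp only [integral_const_mul]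

theorem secondMoment_add_right {f : Ω → ι → ℝ} {h h' : Ω → κ → ℝ} (hf : SqInt μ f)
    (hh : SqInt μ h) (hh' : SqInt μ h') :
    secondMoment μ f (h + h') = secondMoment μ f h + secondMoment μ f h' := by
  rw [← secondMoment_transpose, secondMoment_add_left hh hh' hf, Matrix.transpose_add,
    secondMoment_transpose, secondMoment_transpose]

theorem secondMoment_sub_right {f : Ω → ι → ℝ} {h h' : Ω → κ → ℝ} (hf : SqInt μ f)
    (hh : SqInt μ h) (hh' : SqInt μ h') :
    secondMoment μ f (h - h') = secondMoment μ f h - secondMoment μ f h' := by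
  rw [← secondMoment_transpose, secondMoment_sub_left hh hh' hf, Matrix.transpose_sub,
    secondMoment_transpose, secondMoment_transpose]

theorem secondMoment_mulVec_right {f : Ω → ι → ℝ} {h : Ω → κ → ℝ} (hf : SqInt μ f)
    (hh : SqInt μ h) (A : Matrix ν κ ℝ) :
    secondMoment μ f (fun ω => A *ᵥ h ω) = secondMoment μ f h * Aᵀ := by
  rw [← secondMoment_transpose, secondMoment_mulVec_left hh hf, Matrix.transpose_mul,
    secondMoment_transpose]

theorem secondMoment_comb_eq_zero {f : Ω → ι → ℝ} {x g : Ω → ν → ℝ} {h : Ω → κ → ℝ}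
    {A : Matrix ν ι ℝ} (hx : x = (fun ω => A *ᵥ f ω) + g) (hf : SqInt μ f) (hg : SqInt μ g)
    (hh : SqInt μ h) (h1 : secondMoment μ f h = 0) (h2 : secondMoment μ g h = 0) :
    secondMoment μ x h = 0 := by
  rw [hx, secondMoment_add_left (hf.mulVec A) hg hh, secondMoment_mulVec_left hf hh, h1, h2,
    Matrix.mul_zero, add_zero]

theorem SqInt.integrable_quad {f : Ω → ι → ℝ} (hf : SqInt μ f) (A : Matrix ι ι ℝ) :
    Integrable (fun ω => f ω ⬝ᵥ A *ᵥ f ω) μ := by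
  simp only [dotProduct]
  exact integrable_finsetSum _ fun i _ => hf.integrable_mul (hf.mulVec A) i i

theorem integral_quad {f : Ω → ι → ℝ} (hf : SqInt μ f) (A : Matrix ι ι ℝ) :
    ∫ ω, f ω ⬝ᵥ A *ᵥ f ω ∂μ = (A * secondMoment μ f f).trace := by
  rw [← secondMoment_mulVec_left hf hf, Matrix.trace]
  simp only [dotProduct, Matrix.diag_apply, secondMoment, Matrix.of_apply]
  rw [integral_finsetSum _ fun i _ => hf.integrable_mul (hf.mulVec A) i i]
  simp only [mul_comm]

theorem SqInt.integrable_dotProduct {f : Ω → ι → ℝ} (hf : SqInt μ f) :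
    Integrable (fun ω => f ω ⬝ᵥ f ω) μ := by
  simp only [dotProduct]
  exact integrable_finsetSum _ fun i _ => hf.integrable_mul hf i i

theorem integral_dotProduct {f : Ω → ι → ℝ} (hf : SqInt μ f) :
    ∫ ω, f ω ⬝ᵥ f ω ∂μ = (secondMoment μ f f).trace := by
  classical
  simpa using integral_quad hf 1

theorem secondMoment_self_posSemidef {f : Ω → ι → ℝ} (hf : SqInt μ f) :
    (secondMoment μ f f).PosSemidef := by
  refine Matrix.posSemidef_of_quad (secondMoment_transpose f f) fun v => ?_
  have h : v ⬝ᵥ secondMoment μ f f *ᵥ v = ∫ ω, (v ⬝ᵥ f ω) ^ 2 ∂μ := by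
    simp only [dotProduct, Matrix.mulVec, sq, Finset.sum_mul_sum, secondMoment, Matrix.of_apply]
    simp only [Finset.mul_sum]
    have hi : ∀ i j, Integrable (fun ω => v i * f ω i * (v j * f ω j)) μ := fun i j => by
      have := (hf.integrable_mul hf i j).const_mul (v i * v j)
      exact this.congr (ae_of_all _ fun ω => by ring)
    rw [integral_finsetSum _ fun i _ => integrable_finsetSum _ fun j _ => hi i j]
    refine Finset.sum_congr rfl fun i _ => ?_
    rw [integral_finsetSum _ fun j _ => hi i j]
    refine Finset.sum_congr rfl fun j _ => ?_
    rw [mul_comm _ (v j), ← mul_assoc, ← integral_const_mul]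
    congr 1
    funext ω
    ring
  rw [h]
  exact integral_nonneg fun ω => sq_nonneg _

end SecondMoment

/-! ### Orthogonality in the filter -/

namespace DesignData

variable {L : ℕ} {Y U D G : Type*}
  [Fintype Y] [Fintype U] [Fintype D] [Fintype G]
  [DecidableEq Y] [DecidableEq U] [DecidableEq D] [DecidableEq G]
  {S : DesignData L Y U D G} {Ω : Type*} [MeasurableSpace Ω] {μ : Measure Ω}

/-- Process noise `q` and measurement noise `n`, both white with zero mean and mutually
uncorrelated. -/
structure FilterNoise (S : DesignData L Y U D G) (μ : Measure Ω) (q : ℕ → Ω → G → ℝ)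
    (n : ℕ → Ω → Y ⊕ U ⊕ D → ℝ) : Prop where
  sq_q : ∀ k, SqInt μ (q k)
  sq_n : ∀ k, SqInt μ (n k)
  mean_q : ∀ k (c : G → ℝ), secondMoment μ (fun _ => c) (q k) = 0
  mean_n : ∀ k (c : G → ℝ), secondMoment μ (fun _ => c) (n k) = 0
  cov_q : ∀ k, secondMoment μ (q k) (q k) = S.calQ
  cov_n : ∀ k, secondMoment μ (n k) (n k) = S.Sn
  white_q : ∀ j k, j ≠ k → secondMoment μ (q j) (q k) = 0
  white_n : ∀ j k, j ≠ k → secondMoment μ (n j) (n k) = 0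
  cross : ∀ j k, secondMoment μ (q j) (n k) = 0

/-- The second moments of the estimation error `e` and the estimate `a` at time `k`. -/
structure FilterState (μ : Measure Ω) (q : ℕ → Ω → G → ℝ)
    (n : ℕ → Ω → Y ⊕ U ⊕ D → ℝ) (k : ℕ) (P : Matrix G G ℝ) (e a : Ω → G → ℝ) : Prop where
  sq_e : SqInt μ e
  sq_a : SqInt μ a
  mean_e : ∀ c : G → ℝ, secondMoment μ (fun _ => c) e = 0
  orth : secondMoment μ a e = 0
  cov_e : secondMoment μ e e = P
  e_q : ∀ j ≥ k, secondMoment μ e (q j) = 0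
  e_n : ∀ j ≥ k, secondMoment μ e (n j) = 0
  a_q : ∀ j ≥ k, secondMoment μ a (q j) = 0
  a_n : ∀ j ≥ k, secondMoment μ a (n j) = 0

/-- One step of the filter: the second moments are propagated, and the second moment of the
estimate grows by that of the innovation. -/
theorem FilterState.step [IsProbabilityMeasure μ] (hS : S.NoisePos) {q : ℕ → Ω → G → ℝ}
    {n : ℕ → Ω → Y ⊕ U ⊕ D → ℝ} (hN : S.FilterNoise μ q n) {k : ℕ} {P : Matrix G G ℝ}
    {e a : Ω → G → ℝ} (hk : FilterState μ q n k P e a) (A : Matrix G G ℝ) (b : G → ℝ)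
    {e' a' em am : Ω → G → ℝ}
    (hem : em = (fun ω => S.Ep *ᵥ e ω) + q k) (ham : am = (fun ω => A *ᵥ a ω) + fun _ => b)
    (he' : e' = em - fun ω => S.gain (S.priorCov P) *ᵥ (S.F_w *ᵥ em ω + n k ω))
    (ha' : a' = am + fun ω => S.gain (S.priorCov P) *ᵥ (S.F_w *ᵥ em ω + n k ω)) :
    FilterState μ q n (k + 1) (S.riccati P) e' a' ∧ SqInt μ am ∧
      secondMoment μ a' a' = secondMoment μ am am + S.calN P := by
  have hP : P.PosSemidef := hk.cov_e ▸ secondMoment_self_posSemidef hk.sq_e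
  set K := S.gain (S.priorCov P) with hK
  have sEe := hk.sq_e.mulVec S.Ep
  have sAa := hk.sq_a.mulVec A
  have sb := SqInt.const (μ := μ) b
  have sq := hN.sq_q k
  have sn := hN.sq_n k
  have sem : SqInt μ em := hem ▸ sEe.add sq
  have sam : SqInt μ am := ham ▸ sAa.add sb
  obtain ⟨i, hi⟩ : ∃ i : Ω → Y ⊕ U ⊕ D → ℝ, i = (fun ω => S.F_w *ᵥ em ω) + n k := ⟨_, rfl⟩
  have sFe := sem.mulVec S.F_w
  have si : SqInt μ i := hi ▸ sFe.add sn
  have sKi := si.mulVec K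
  replace he' : e' = em - fun ω => K *ᵥ i ω := by rw [he', hi]; rfl
  replace ha' : a' = am + fun ω => K *ᵥ i ω := by rw [ha', hi]; rfl
  have he'' : e' = (fun ω => (-K) *ᵥ i ω) + em := by
    rw [he']; funext ω; simp [Matrix.neg_mulVec, sub_eq_add_neg, add_comm]
  have ha'' : a' = (fun ω => K *ᵥ i ω) + am := by rw [ha', add_comm]
  have em_em : secondMoment μ em em = S.priorCov P := by
    rw [hem, secondMoment_add_left sEe sq (sEe.add sq), secondMoment_add_right sEe sEe sq,
      secondMoment_add_right sq sEe sq, secondMoment_mulVec_left hk.sq_e sEe,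
      secondMoment_mulVec_left hk.sq_e sq, secondMoment_mulVec_right hk.sq_e hk.sq_e,
      secondMoment_mulVec_right sq hk.sq_e, hk.e_q k le_rfl,
      secondMoment_eq_zero_symm (hk.e_q k le_rfl), hk.cov_e, hN.cov_q, priorCov_eq]
    simp [Matrix.mul_assoc]
  have em_n : ∀ j ≥ k, secondMoment μ em (n j) = 0 := fun j hj =>
    secondMoment_comb_eq_zero hem hk.sq_e sq (hN.sq_n j) (hk.e_n j hj) (hN.cross k j)
  have am_n : ∀ j ≥ k, secondMoment μ am (n j) = 0 := fun j hj =>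
    secondMoment_comb_eq_zero ham hk.sq_a sb (hN.sq_n j) (hk.a_n j hj) (hN.mean_n j b)
  have em_q : ∀ j ≥ k + 1, secondMoment μ em (q j) = 0 := fun j hj =>
    secondMoment_comb_eq_zero hem hk.sq_e sq (hN.sq_q j) (hk.e_q j (by omega))
      (hN.white_q k j (by omega))
  have am_q : ∀ j ≥ k, secondMoment μ am (q j) = 0 := fun j hj =>
    secondMoment_comb_eq_zero ham hk.sq_a sb (hN.sq_q j) (hk.a_q j hj) (hN.mean_q j b)
  -- The deterministic drift `b` is harmless because the error has mean zero.
  have am_e : secondMoment μ am e = 0 :=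
    secondMoment_comb_eq_zero ham hk.sq_a sb hk.sq_e hk.orth (hk.mean_e b)
  have am_em : secondMoment μ am em = 0 := by
    rw [hem, secondMoment_add_right sam sEe sq, secondMoment_mulVec_right sam hk.sq_e, am_e,
      am_q k le_rfl]
    simp
  have em_i : secondMoment μ em i = S.priorCov P * S.F_wᵀ := by
    rw [hi, secondMoment_add_right sem sFe sn, secondMoment_mulVec_right sem sem, em_em,
      em_n k le_rfl, add_zero]
  have i_em : secondMoment μ i em = S.F_w * S.priorCov P := by
    rw [← secondMoment_transpose, em_i, Matrix.transpose_mul, Matrix.transpose_transpose,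
      (hS.priorCov hP).transpose_eq]
  have i_i : secondMoment μ i i = S.innov (S.priorCov P) := by
    conv_lhs => rw [hi]
    rw [secondMoment_add_left sFe sn (sFe.add sn), ← hi, secondMoment_mulVec_left sem si, em_i,
      hi, secondMoment_add_right sn sFe sn, secondMoment_mulVec_right sn sem,
      secondMoment_eq_zero_symm (em_n k le_rfl), hN.cov_n, innov]
    simp [Matrix.mul_assoc]
  have am_i : secondMoment μ am i = 0 := by
    rw [hi, secondMoment_add_right sam sFe sn, secondMoment_mulVec_right sam sem, am_em,
      am_n k le_rfl]
    simp
  have c_f : ∀ c : G → ℝ, secondMoment μ (fun _ => c) em = 0 := fun c => by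
    have sc := SqInt.const (μ := μ) c
    exact secondMoment_eq_zero_symm (secondMoment_comb_eq_zero hem hk.sq_e sq sc
      (secondMoment_eq_zero_symm (hk.mean_e c))
      (secondMoment_eq_zero_symm (hN.mean_q k c)))
  have c_i : ∀ c : G → ℝ, secondMoment μ (fun _ => c) i = 0 := fun c => by
    have sc := SqInt.const (μ := μ) c
    exact secondMoment_eq_zero_symm (secondMoment_comb_eq_zero hi sem sn sc
      (secondMoment_eq_zero_symm (c_f c))
      (secondMoment_eq_zero_symm (hN.mean_n k c)))
  have i_q : ∀ j ≥ k + 1, secondMoment μ i (q j) = 0 := fun j hj =>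
    secondMoment_comb_eq_zero hi sem sn (hN.sq_q j) (em_q j hj)
      (secondMoment_eq_zero_symm (hN.cross j k))
  have i_n : ∀ j ≥ k + 1, secondMoment μ i (n j) = 0 := fun j hj =>
    secondMoment_comb_eq_zero hi sem sn (hN.sq_n j) (em_n j (by omega)) (hN.white_n k j (by omega))
  have se' : SqInt μ e' := he' ▸ sem.sub sKi
  -- The property that characterizes the filter gain: the posterior error is orthogonal to the
  -- innovation.
  have i_e' : secondMoment μ i e' = 0 := by
    rw [he', secondMoment_sub_right si sem sKi, secondMoment_mulVec_right si si, i_em, i_i,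
      hS.innov_mul_gain (hS.priorCov hP), sub_self]
  have am_e' : secondMoment μ am e' = 0 := by
    rw [he', secondMoment_sub_right sam sem sKi, secondMoment_mulVec_right sam si, am_em, am_i]
    simp
  refine ⟨⟨se', ha' ▸ sam.add sKi, fun c => ?_,
    secondMoment_comb_eq_zero ha'' si sam se' i_e' am_e', ?_, fun j hj =>
    secondMoment_comb_eq_zero he'' si sem (hN.sq_q j) (i_q j hj) (em_q j hj), fun j hj =>
    secondMoment_comb_eq_zero he'' si sem (hN.sq_n j) (i_n j hj) (em_n j (by omega)), fun j hj =>
    secondMoment_comb_eq_zero ha'' si sam (hN.sq_q j) (i_q j hj) (am_q j (by omega)), fun j hj =>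
    secondMoment_comb_eq_zero ha'' si sam (hN.sq_n j) (i_n j hj) (am_n j (by omega))⟩, sam, ?_⟩
  · have sc := SqInt.const (μ := μ) c
    exact secondMoment_eq_zero_symm (secondMoment_comb_eq_zero he'' si sem sc
      (secondMoment_eq_zero_symm (c_i c))
      (secondMoment_eq_zero_symm (c_f c)))
  · conv_lhs => rw [he']
    rw [secondMoment_sub_left sem sKi (he' ▸ se'), ← he', secondMoment_mulVec_left si se', i_e',
      Matrix.mul_zero, sub_zero, he', secondMoment_sub_right sem sem sKi,
      secondMoment_mulVec_right sem si, em_em, em_i, riccati, Matrix.sub_mul, Matrix.one_mul,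
      ← hS.gain_mul_innov (hS.priorCov hP), hS.gain_innov_gain (hS.priorCov hP)]
  · rw [ha', secondMoment_add_left sam sKi (sam.add sKi), secondMoment_add_right sam sam sKi,
      secondMoment_add_right sKi sam sKi, secondMoment_mulVec_right sam si,
      secondMoment_mulVec_left si sam, secondMoment_mulVec_left si sKi,
      secondMoment_mulVec_right si si, am_i, secondMoment_eq_zero_symm am_i, i_i, calN_eq hS hP,
      ← hS.gain_innov_gain (hS.priorCov hP), ← hK]
    simp [Matrix.mul_assoc]

end DesignData

/-! ### Moments of the noise -/

section Noise

variable {Ω : Type*} [MeasurableSpace Ω] {μ : Measure Ω}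
  {ι κ : Type*} [Fintype ι] [Fintype κ]

theorem IsWhiteNoise.sqInt {C : Matrix ι ι ℝ} {ξ : ℕ → Ω → ι → ℝ} (h : IsWhiteNoise μ C ξ)
    (k : ℕ) : SqInt μ (ξ k) :=
  h.memLp k

theorem IsWhiteNoise.secondMoment_self {C : Matrix ι ι ℝ} {ξ : ℕ → Ω → ι → ℝ}
    (h : IsWhiteNoise μ C ξ) (k : ℕ) : secondMoment μ (ξ k) (ξ k) = C := by
  ext i j
  simp [secondMoment, h.cov]

theorem IsWhiteNoise.secondMoment_ne {C : Matrix ι ι ℝ} {ξ : ℕ → Ω → ι → ℝ}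
    (h : IsWhiteNoise μ C ξ) {j k : ℕ} (hjk : j ≠ k) : secondMoment μ (ξ j) (ξ k) = 0 := by
  ext a b
  simp [secondMoment, h.cov, hjk]

theorem IsWhiteNoise.secondMoment_const {C : Matrix ι ι ℝ} {ξ : ℕ → Ω → ι → ℝ}
    (h : IsWhiteNoise μ C ξ) (k : ℕ) (c : κ → ℝ) : secondMoment μ (fun _ => c) (ξ k) = 0 := by
  ext a b
  simp [secondMoment, integral_const_mul, h.mean]

/-- Independence factorizes the mixed moment and the zero mean of the noise kills it. The map `φ`
extracts one vector from a whole process or from the pair of initial data. -/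
theorem IsWhiteNoise.secondMoment_indep {C : Matrix ι ι ℝ} {ξ : ℕ → Ω → ι → ℝ}
    (h : IsWhiteNoise μ C ξ) {α : Type*} [MeasurableSpace α] {f : Ω → α} {φ : α → κ → ℝ}
    (hφ : Measurable φ) (hf : SqInt μ fun ω => φ (f ω))
    (hind : IndepFun f (fun ω k => ξ k ω) μ) (k : ℕ) :
    secondMoment μ (fun ω => φ (f ω)) (ξ k) = 0 := by
  ext a b
  have h1 : IndepFun (fun ω => φ (f ω) a) (fun ω => ξ k ω b) μ :=
    hind.comp (φ := fun x => φ x a) (ψ := fun y : ℕ → ι → ℝ => y k b)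
      ((measurable_pi_apply a).comp hφ) ((measurable_pi_apply b).comp (measurable_pi_apply k))
  have h2 := h1.integral_fun_mul_eq_mul_integral (hf a).aestronglyMeasurable
    (h.memLp k b).aestronglyMeasurable
  simp only [secondMoment, Matrix.of_apply, Matrix.zero_apply]
  rw [h2, h.mean, mul_zero]

end Noise

namespace DesignData

variable {L : ℕ} {Y U D G : Type*}
  [Fintype Y] [Fintype U] [Fintype D] [Fintype G]
  [DecidableEq Y] [DecidableEq U] [DecidableEq D] [DecidableEq G]
  {S : DesignData L Y U D G} {Ω : Type*} [MeasurableSpace Ω] {μ : Measure Ω}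

/-- The noise that drives the parameterizer. -/
noncomputable def processNoise (S : DesignData L Y U D G) (Δd : ℕ → Ω → D → ℝ)
    (Δu : ℕ → Ω → U → ℝ) (k : ℕ) : Ω → G → ℝ :=
  (fun ω => S.Ef *ᵥ Δd (k + 1) ω) + fun ω => S.Eu *ᵥ Δu (k + 1) ω

section

variable [IsProbabilityMeasure μ] {Δd : ℕ → Ω → D → ℝ} {Δu : ℕ → Ω → U → ℝ}
  {n : ℕ → Ω → Y ⊕ U ⊕ D → ℝ}

theorem _root_.NoiseModel.du (h : NoiseModel μ S Δd Δu n) (j k : ℕ) :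
    secondMoment μ (Δd (j + 1)) (Δu (k + 1)) = 0 :=
  h.input.toIsWhiteNoise.secondMoment_indep (φ := fun x : ℕ → D → ℝ => x j)
    (measurable_pi_apply j)
    (h.dist.toIsWhiteNoise.sqInt j) h.indep_du k

theorem _root_.NoiseModel.dn (h : NoiseModel μ S Δd Δu n) (j k : ℕ) :
    secondMoment μ (Δd (j + 1)) (n (k + 1)) = 0 :=
  h.meas.secondMoment_indep (φ := fun x : ℕ → D → ℝ => x j)
    (measurable_pi_apply j)
    (h.dist.toIsWhiteNoise.sqInt j) h.indep_dn k

theorem _root_.NoiseModel.un (h : NoiseModel μ S Δd Δu n) (j k : ℕ) :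
    secondMoment μ (Δu (j + 1)) (n (k + 1)) = 0 :=
  h.meas.secondMoment_indep (φ := fun x : ℕ → U → ℝ => x j)
    (measurable_pi_apply j)
    (h.input.toIsWhiteNoise.sqInt j) h.indep_un k

theorem _root_.NoiseModel.filterNoise (h : NoiseModel μ S Δd Δu n) :
    S.FilterNoise μ (S.processNoise Δd Δu) (fun k => n (k + 1)) := by
  have sd := h.dist.toIsWhiteNoise.sqInt
  have su := h.input.toIsWhiteNoise.sqInt
  have sd' := fun k => (sd k).mulVec S.Ef
  have su' := fun k => (su k).mulVec S.Eu
  have sn := h.meas.sqInt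
  have hcov : ∀ j k, secondMoment μ (S.processNoise Δd Δu j)
      (S.processNoise Δd Δu k) =
      S.Ef * secondMoment μ (Δd (j + 1)) (Δd (k + 1)) * S.Efᵀ +
      S.Eu * secondMoment μ (Δu (j + 1)) (Δu (k + 1)) * S.Euᵀ := by
    intro j k
    rw [processNoise, processNoise,
      secondMoment_add_left (sd' j) (su' j) ((sd' k).add (su' k)),
      secondMoment_add_right (sd' j) (sd' k) (su' k),
      secondMoment_add_right (su' j) (sd' k) (su' k),
      secondMoment_mulVec_left (sd j) (sd' k), secondMoment_mulVec_left (sd j) (su' k),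
      secondMoment_mulVec_left (su j) (sd' k), secondMoment_mulVec_left (su j) (su' k),
      secondMoment_mulVec_right (sd j) (sd k), secondMoment_mulVec_right (sd j) (su k),
      secondMoment_mulVec_right (su j) (sd k), secondMoment_mulVec_right (su j) (su k),
      h.du, secondMoment_eq_zero_symm (h.du k j)]
    simp [Matrix.mul_assoc]
  refine ⟨fun k => (sd' k).add (su' k), sn, fun k c => ?_,
    fun k c => h.meas.secondMoment_const k c, fun k => ?_, h.meas.secondMoment_self,
    fun j k hjk => ?_, fun j k hjk => h.meas.secondMoment_ne hjk, fun j k => ?_⟩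
  · have sc := SqInt.const (μ := μ) c
    rw [processNoise, secondMoment_add_right sc (sd' k) (su' k),
      secondMoment_mulVec_right sc (sd k), secondMoment_mulVec_right sc (su k),
      h.dist.toIsWhiteNoise.secondMoment_const k c,
      h.input.toIsWhiteNoise.secondMoment_const k c]
    simp
  · rw [hcov, h.dist.toIsWhiteNoise.secondMoment_self k,
      h.input.toIsWhiteNoise.secondMoment_self k, calQ]
  · rw [hcov, h.dist.toIsWhiteNoise.secondMoment_ne hjk,
      h.input.toIsWhiteNoise.secondMoment_ne hjk]
    simp
  · refine secondMoment_comb_eq_zero rfl (sd j) (su' j) (sn k) (h.dn j k) ?_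
    rw [secondMoment_mulVec_left (su j) (sn k), h.un, Matrix.mul_zero]

theorem _root_.InitialModel.filterState (hn : NoiseModel μ S Δd Δu n) {P₀ : Matrix G G ℝ}
    {g₀ ghat₀ : Ω → G → ℝ} (h : InitialModel μ P₀ Δd Δu n g₀ ghat₀) :
    FilterState μ (S.processNoise Δd Δu) (fun k => n (k + 1)) 0 P₀
      (g₀ - ghat₀) ghat₀ := by
  have sg : SqInt μ g₀ := h.memLp_g
  have sa : SqInt μ ghat₀ := h.memLp_ghat
  have se := sg.sub sa
  have sd := hn.dist.toIsWhiteNoise.sqInt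
  have su := hn.input.toIsWhiteNoise.sqInt
  have hq : ∀ {f : Ω → G → ℝ}, SqInt μ f → (∀ j, secondMoment μ f (Δd (j + 1)) = 0) →
      (∀ j, secondMoment μ f (Δu (j + 1)) = 0) →
      ∀ j, secondMoment μ f (S.processNoise Δd Δu j) = 0 := by
    intro f sf h1 h2 j
    rw [processNoise, secondMoment_add_right sf ((sd j).mulVec _) ((su j).mulVec _),
      secondMoment_mulVec_right sf (sd j), secondMoment_mulVec_right sf (su j), h1, h2]
    simp
  have me : Measurable fun z : (G → ℝ) × (G → ℝ) => z.1 - z.2 := by fun_prop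
  have ma : Measurable fun z : (G → ℝ) × (G → ℝ) => z.2 := by fun_prop
  refine ⟨se, sa, fun c => ?_, ?_, ?_, fun j _ => hq se (fun j => ?_) (fun j => ?_) j,
    fun j _ => ?_, fun j _ => hq sa (fun j => ?_) (fun j => ?_) j, fun j _ => ?_⟩
  · ext a b
    simp only [secondMoment, Matrix.of_apply, Pi.sub_apply, integral_const_mul, h.mean_err,
      mul_zero, Matrix.zero_apply]
  · ext a b
    exact h.uncorrelated a b
  · ext a b
    exact h.cov_err a b
  · exact hn.dist.toIsWhiteNoise.secondMoment_indep me se h.indep_d j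
  · exact hn.input.toIsWhiteNoise.secondMoment_indep me se h.indep_u j
  · exact hn.meas.secondMoment_indep me se h.indep_n j
  · exact hn.dist.toIsWhiteNoise.secondMoment_indep ma sa h.indep_d j
  · exact hn.input.toIsWhiteNoise.secondMoment_indep ma sa h.indep_u j
  · exact hn.meas.secondMoment_indep ma sa h.indep_n j

end

/-! ### The energy of the output -/

/-- The parameterizers of a closed loop, and the propagation of the second moments of the filter. -/
theorem IsClosedLoop.exists_filter [IsProbabilityMeasure μ] {B : Set (ℕ → Y ⊕ U ⊕ D → ℝ)}
    (hB : S.Parameterizes B) (hS : S.NoisePos) {P₀ W : Matrix G G ℝ} {Yg : Matrix U G ℝ}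
    {Kd : Matrix U D ℝ} {m : ℕ → D → ℝ} {Δd : ℕ → Ω → D → ℝ} {Δu : ℕ → Ω → U → ℝ}
    {n : ℕ → Ω → Y ⊕ U ⊕ D → ℝ} {g₀ ghat₀ : Ω → G → ℝ} {w : ℕ → Ω → Y ⊕ U ⊕ D → ℝ}
    {gprior gpost : ℕ → Ω → G → ℝ}
    (hn : NoiseModel μ S Δd Δu n) (hi : InitialModel μ P₀ Δd Δu n g₀ ghat₀)
    (h : S.IsClosedLoop B P₀ W Yg Kd m Δd Δu n g₀ ghat₀ w gprior gpost) :
    ∃ e : ℕ → Ω → G → ℝ,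
      (∀ k ω i, w (L + k) ω (Sum.inl i) = (S.F_y *ᵥ (e k + gpost k) ω) i) ∧
      (∀ k, FilterState μ (S.processNoise Δd Δu) (fun k => n (k + 1)) k
        (S.postCov P₀ k) (e k) (gpost k)) ∧
      ∀ k, SqInt μ (gprior (k + 1)) ∧ secondMoment μ (gpost (k + 1)) (gpost (k + 1)) =
        secondMoment μ (gprior (k + 1)) (gprior (k + 1)) + S.calN (S.postCov P₀ k) := by
  choose g hg using fun (k : ℕ) ω => hB.exists_param (h.mem ω) k
  have hg0 : g 0 = g₀ := by
    funext ω
    apply hB.injective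
    funext p
    rw [hg 0 ω p, ← h.init_window ω p, zero_add]
  have hlast : ∀ k ω, S.F_w *ᵥ g k ω = w (L + k) ω := fun k ω => by
    rw [(hg k ω).F_w, add_comm]
  -- Control action and mean disturbance cancel between plant and prediction, so only noise drives
  -- the error.
  have hpred : ∀ k, g (k + 1) - gprior (k + 1) =
      (fun ω => S.Ep *ᵥ (g k - gpost k) ω) + S.processNoise Δd Δu k := by
    intro k
    funext ω
    have h1 := hB.next_eq ((hg k ω).shift (hg (k + 1) ω))
    have hd : S.F_dk *ᵥ g (k + 1) ω = m (k + 1) + Δd (k + 1) ω := by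
      funext i
      have := congrFun (hlast (k + 1) ω) (Sum.inr (Sum.inr i))
      rw [h.disturbance] at this
      exact this
    have hu : S.F_u *ᵥ g (k + 1) ω = S.F_u *ᵥ gprior (k + 1) ω + Δu (k + 1) ω := by
      funext i
      have := congrFun (hlast (k + 1) ω) (Sum.inr (Sum.inl i))
      rw [h.input] at this
      exact this
    rw [hd, hu] at h1
    have h2 := hB.control_eq (Yg * W⁻¹) Kd (gpost k ω) (m (k + 1))
    rw [← Matrix.mul_assoc, ← h.control] at h2
    simp only [Pi.sub_apply, Pi.add_apply, processNoise, Matrix.mulVec_sub]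
    generalize S.F_u *ᵥ gprior (k + 1) ω = x at h1 h2
    rw [h1, h2, Matrix.mulVec_add, Matrix.mulVec_add]
    abel
  have hinn : ∀ k ω, S.F_w *ᵥ (g (k + 1) - gprior (k + 1)) ω + n (k + 1) ω =
      w (L + (k + 1)) ω + n (k + 1) ω - S.F_w *ᵥ gprior (k + 1) ω := fun k ω => by
    rw [Pi.sub_apply, Matrix.mulVec_sub, hlast, sub_add_eq_add_sub]
  have hstep := fun k (hk : FilterState μ (S.processNoise Δd Δu) (fun k => n (k + 1)) k
      (S.postCov P₀ k) (g k - gpost k) (gpost k)) =>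
    hk.step hS hn.filterNoise (S.Fp + S.Fz * Yg * W⁻¹) ((S.Ff + S.Fz * Kd) *ᵥ m (k + 1))
      (e' := g (k + 1) - gpost (k + 1)) (a' := gpost (k + 1)) (am := gprior (k + 1)) (hpred k)
      (funext fun ω => h.control k ω)
      (by
        funext ω
        rw [Pi.sub_apply, Pi.sub_apply, hinn, h.update, sub_add_eq_sub_sub]
        rfl)
      (by
        funext ω
        rw [Pi.add_apply, hinn, h.update]
        rfl)
  have hstate : ∀ k, FilterState μ (S.processNoise Δd Δu) (fun k => n (k + 1)) k
      (S.postCov P₀ k) (g k - gpost k) (gpost k) := by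
    intro k
    induction k with
    | zero =>
      rw [hg0, h.init_estimate]
      exact hi.filterState hn
    | succ k ih => exact (hstep k ih).1
  refine ⟨fun k => g k - gpost k, fun k ω i => ?_, hstate, fun k => (hstep k (hstate k)).2⟩
  rw [sub_add_cancel]
  exact (congrFun (hlast k ω) (Sum.inl i)).symm

/-- The part of the running cost of the closed loop that is due to the uncertainties. -/
noncomputable def noiseCost (S : DesignData L Y U D G) (P₀ W : Matrix G G ℝ) (k : ℕ) : ℝ :=
  (W⁻¹ * S.calN (S.postCov P₀ k)).trace + (S.F_y * S.postCov P₀ (k + 1) * S.F_yᵀ).trace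

/-- The dissipation inequality in expectation, telescoped with the mean storage `V` of the posterior
estimate; `C` is the initial mean storage. -/
theorem IsClosedLoop.energy_le [IsProbabilityMeasure μ] {B : Set (ℕ → Y ⊕ U ⊕ D → ℝ)}
    (hB : S.Parameterizes B) (hS : S.NoisePos) {P : Matrix G G ℝ} {γ₁ γ₂ : ℝ}
    {P₀ W X : Matrix G G ℝ} {Yg : Matrix U G ℝ} {Kd : Matrix U D ℝ}
    (hLMI : S.LMIs P γ₁ γ₂ W X Yg Kd)
    {m : ℕ → D → ℝ} {Δd : ℕ → Ω → D → ℝ} {Δu : ℕ → Ω → U → ℝ}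
    {n : ℕ → Ω → Y ⊕ U ⊕ D → ℝ} {g₀ ghat₀ : Ω → G → ℝ} {w : ℕ → Ω → Y ⊕ U ⊕ D → ℝ}
    {gprior gpost : ℕ → Ω → G → ℝ}
    (hn : NoiseModel μ S Δd Δu n) (hi : InitialModel μ P₀ Δd Δu n g₀ ghat₀)
    (h : S.IsClosedLoop B P₀ W Yg Kd m Δd Δu n g₀ ghat₀ w gprior gpost) :
    (∀ k, Integrable (fun ω => ∑ i, w (L + k) ω (Sum.inl i) ^ 2) μ) ∧
    ∃ C, ∀ T, ∑ k ∈ Finset.range T, ∫ ω, ∑ i, w (L + (k + 1)) ω (Sum.inl i) ^ 2 ∂μ ≤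
      C + ∑ k ∈ Finset.range T, (γ₁ ^ 2 * ∑ i, m (k + 1) i ^ 2 + S.noiseCost P₀ W k) := by
  obtain ⟨e, hy, hst, hpr⟩ := h.exists_filter hB hS hn hi
  have sa := fun k => (hst k).sq_a
  have se := fun k => (hst k).sq_e
  have sFa := fun k => (sa k).mulVec S.F_y
  have hye : ∀ k ω, ∑ i, w (L + k) ω (Sum.inl i) ^ 2 =
      (S.F_y *ᵥ (e k + gpost k) ω) ⬝ᵥ (S.F_y *ᵥ (e k + gpost k) ω) := fun k ω => by
    simp only [hy, dotProduct, sq]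
  have sy := fun k => ((se k).add (sa k)).mulVec S.F_y
  refine ⟨fun k => ?_, (W⁻¹ * secondMoment μ (gpost 0) (gpost 0)).trace, fun T => ?_⟩
  · simp only [hye]
    exact (sy k).integrable_dotProduct
  set V : ℕ → ℝ := fun k => (W⁻¹ * secondMoment μ (gpost k) (gpost k)).trace with hV
  set a : ℕ → ℝ := fun k => ∫ ω, (S.F_y *ᵥ gpost k ω) ⬝ᵥ (S.F_y *ᵥ gpost k ω) ∂μ with ha
  -- Estimate and error are orthogonal, so their contributions to the output energy add.
  have hcost : ∀ k, ∫ ω, ∑ i, w (L + k) ω (Sum.inl i) ^ 2 ∂μ =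
      a k + (S.F_y * S.postCov P₀ k * S.F_yᵀ).trace := by
    intro k
    simp only [hye, ha]
    have sea := (se k).add (sa k)
    rw [integral_dotProduct (sy k), integral_dotProduct (sFa k),
      secondMoment_mulVec_left sea (sy k), secondMoment_mulVec_right sea sea,
      secondMoment_mulVec_left (sa k) (sFa k), secondMoment_mulVec_right (sa k) (sa k),
      secondMoment_add_left (se k) (sa k) sea, secondMoment_add_right (se k) (se k) (sa k),
      secondMoment_add_right (sa k) (se k) (sa k), (hst k).orth,
      secondMoment_eq_zero_symm (hst k).orth, (hst k).cov_e, ← Matrix.trace_add, zero_add,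
      add_zero, Matrix.add_mul, Matrix.mul_add, Matrix.mul_assoc, add_comm]
  have hVk : ∀ k, V k = ∫ ω, gpost k ω ⬝ᵥ W⁻¹ *ᵥ gpost k ω ∂μ := fun k =>
    (integral_quad (sa k) _).symm
  have hdiss : ∀ k, a k + V (k + 1) ≤
      V k + γ₁ ^ 2 * ∑ i, m (k + 1) i ^ 2 + (W⁻¹ * S.calN (S.postCov P₀ k)).trace := by
    intro k
    have hV1 : V (k + 1) = ∫ ω, gprior (k + 1) ω ⬝ᵥ W⁻¹ *ᵥ gprior (k + 1) ω ∂μ +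
        (W⁻¹ * S.calN (S.postCov P₀ k)).trace := by
      rw [integral_quad (hpr k).1]
      simp only [hV]
      rw [(hpr k).2, Matrix.mul_add, Matrix.trace_add]
    have hint := integral_mono
      (((sFa k).integrable_dotProduct).add ((hpr k).1.integrable_quad W⁻¹))
      (((sa k).integrable_quad W⁻¹).add (integrable_const (γ₁ ^ 2 * ∑ i, m (k + 1) i ^ 2)))
      (fun ω => by
        have := hLMI.dissipation (gpost k ω) (m (k + 1))
        rw [← h.control] at this
        simpa [dotProduct, sq] using this)
    rw [integral_add' ((sFa k).integrable_dotProduct) ((hpr k).1.integrable_quad W⁻¹),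
      integral_add' ((sa k).integrable_quad W⁻¹) (integrable_const _), integral_const] at hint
    simp only [probReal_univ, one_smul] at hint
    rw [hV1, hVk k]
    linarith
  -- Dissipation charges the outputs at times `0` to `T - 1`, while the claim concerns `1` to `T`.
  -- The terminal storage `V T` pays for the additional output term `a T`.
  have hterm : ∀ k, a k ≤ V k := by
    intro k
    rw [hVk]
    refine integral_mono ((sFa k).integrable_dotProduct) ((sa k).integrable_quad W⁻¹) fun ω => ?_
    have h1 := hLMI.dissipation (gpost k ω) 0
    have h2 := hLMI.pos.inv.posSemidef.quad_nonneg
      ((S.Fp + S.Fz * Yg * W⁻¹) *ᵥ gpost k ω + (S.Ff + S.Fz * Kd) *ᵥ 0)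
    simp only [dotProduct_zero, mul_zero, add_zero] at h1
    linarith
  have ha0 : 0 ≤ a 0 := integral_nonneg fun ω => by
    simp only [dotProduct]
    exact Finset.sum_nonneg fun i _ => mul_self_nonneg _
  have hsum : ∀ T, ∑ k ∈ Finset.range T, a k + V T ≤ V 0 + ∑ k ∈ Finset.range T,
      (γ₁ ^ 2 * ∑ i, m (k + 1) i ^ 2 + (W⁻¹ * S.calN (S.postCov P₀ k)).trace) := by
    intro T
    induction T with
    | zero => simp
    | succ T ih =>
      rw [Finset.sum_range_succ, Finset.sum_range_succ]
      linarith [hdiss T]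
  have hshift : ∑ k ∈ Finset.range T, a (k + 1) ≤ ∑ k ∈ Finset.range T, a k + V T := by
    have h1 := Finset.sum_range_succ a T
    have h2 := Finset.sum_range_succ' a T
    linarith [hterm T]
  have h1 := hsum T
  simp only [hcost, noiseCost, Finset.sum_add_distrib] at h1 ⊢
  linarith

/-- Writing `calN` as prior minus posterior covariance makes the cost a continuous function of two
consecutive covariances, without any inverse depending on them. -/
theorem NoisePos.tendsto_noiseCost (hS : S.NoisePos) {P₀ P W : Matrix G G ℝ}
    (hnc : ∀ g : G → ℝ, ∃ (N : ℕ) (x : ℕ → G → ℝ) (d : ℕ → D → ℝ) (u : ℕ → U → ℝ),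
      x 0 = g ∧ x N = 0 ∧ ∀ k, x (k + 1) = S.Ep *ᵥ x k + S.Ef *ᵥ d k + S.Eu *ᵥ u k)
    (hP : S.SolvesARE P) (hP₀ : P₀.PosSemidef) :
    Tendsto (S.noiseCost P₀ W) atTop
      (𝓝 ((W⁻¹ * S.calN P).trace + (S.F_y * P * S.F_yᵀ).trace)) := by
  have hfix := hS.riccati_of_solvesARE hP
  have hlim := hS.tendsto_postCov hnc hP.1 hfix hP₀
  have hlim1 := (tendsto_add_atTop_iff_nat 1).2 hlim
  have hN : ∀ {Z : Matrix G G ℝ}, Z.PosSemidef → S.calN Z = S.priorCov Z - S.riccati Z :=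
    fun hZ => by rw [hS.riccati_eq_sub hZ, sub_sub_cancel]
  have h1 : ∀ k, S.noiseCost P₀ W k =
      (W⁻¹ * (S.priorCov (S.postCov P₀ k) - S.postCov P₀ (k + 1))).trace +
        (S.F_y * S.postCov P₀ (k + 1) * S.F_yᵀ).trace := fun k => by
    rw [noiseCost, hN (hS.postCov hP₀ k)]
    rfl
  have h2 : S.calN P = S.priorCov P - P := by rw [hN hP.1, hfix]
  rw [h2]
  refine Tendsto.congr (fun k => (h1 k).symm) ?_
  have hc : Continuous fun Z : Matrix G G ℝ => S.priorCov Z := by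
    unfold DesignData.priorCov
    fun_prop
  have hc1 : Continuous fun Z : Matrix G G ℝ => (W⁻¹ * Z).trace := by fun_prop
  have hc2 : Continuous fun Z : Matrix G G ℝ => (S.F_y * Z * S.F_yᵀ).trace := by fun_prop
  exact ((hc1.tendsto _).comp (((hc.tendsto P).comp hlim).sub hlim1)).add
    ((hc2.tendsto P).comp hlim1)

end DesignData

/-! ### The energy of the disturbance -/

section Disturbance

variable {Ω : Type*} [MeasurableSpace Ω] {μ : Measure Ω} [IsProbabilityMeasure μ]
  {D : Type*} [Fintype D] {C : Matrix D D ℝ} {ξ : ℕ → Ω → D → ℝ}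

/-- The averaged energy of i.i.d. noise converges in probability. -/
theorem IsIIDNoise.tendsto_energy (h : IsIIDNoise μ C ξ) {ε : ℝ} (hε : 0 < ε) :
    Tendsto (fun T : ℕ => μ.real {ω | ε ≤
      |(∑ k ∈ Finset.range T, ∑ i, ξ k ω i ^ 2) / T - C.trace|}) atTop (𝓝 0) := by
  have hφ : Measurable fun x : D → ℝ => ∑ i, x i ^ 2 := by fun_prop
  have hint : ∀ k, Integrable (fun ω => ∑ i, ξ k ω i ^ 2) μ := fun k =>
    integrable_finsetSum _ fun i _ => (h.memLp k i).integrable_sq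
  have hmean : ∫ ω, ∑ i, ξ 0 ω i ^ 2 ∂μ = C.trace := by
    rw [integral_finsetSum _ fun i _ => (h.memLp 0 i).integrable_sq, Matrix.trace]
    refine Finset.sum_congr rfl fun i _ => ?_
    have := h.cov 0 0 i i
    rw [if_pos rfl] at this
    simpa only [sq, Matrix.diag_apply] using this
  have hlln := strong_law_ae_real (μ := μ) (fun k ω => ∑ i, ξ k ω i ^ 2) (hint 0)
    (fun j k hjk => (h.indep.comp (fun _ x => ∑ i, x i ^ 2) fun _ => hφ).indepFun hjk)
    (fun k => (h.ident k).comp hφ)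
  rw [hmean] at hlln
  have hmeas : ∀ T : ℕ, AEStronglyMeasurable
      (fun ω => (∑ k ∈ Finset.range T, ∑ i, ξ k ω i ^ 2) / (T : ℝ)) μ := fun T =>
    ((integrable_finsetSum _ fun k _ => hint k).div_const _).aestronglyMeasurable
  exact tendstoInMeasure_iff_measureReal_dist.1 (tendstoInMeasure_of_tendsto_ae hmeas hlln) ε hε

/-- Chebyshev's inequality for the correlation of i.i.d. noise with a deterministic signal. -/
theorem IsIIDNoise.measure_correlation_le (h : IsIIDNoise μ C ξ) (m : ℕ → D → ℝ) (T : ℕ) {c : ℝ}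
    (hc : 0 < c) :
    μ.real {ω | c ≤ |∑ k ∈ Finset.range T, m k ⬝ᵥ ξ k ω|} ≤
      C.trace * (∑ k ∈ Finset.range T, ∑ i, m k i ^ 2) / c ^ 2 := by
  have hL : ∀ k, MemLp (fun ω => m k ⬝ᵥ ξ k ω) 2 μ := fun k => by
    simp only [dotProduct]
    exact memLp_finsetSum _ fun i _ => (h.memLp k i).const_mul _
  have hmean : ∀ k, ∫ ω, m k ⬝ᵥ ξ k ω ∂μ = 0 := fun k => by
    simp only [dotProduct]
    rw [integral_finsetSum _ fun i _ => ((h.memLp k i).integrable one_le_two).const_mul _]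
    simp [integral_const_mul, h.mean]
  have hsq : ∀ k, ∫ ω, ∑ i, ξ k ω i ^ 2 ∂μ = C.trace := fun k => by
    rw [integral_finsetSum _ fun i _ => (h.memLp k i).integrable_sq, Matrix.trace]
    refine Finset.sum_congr rfl fun i _ => ?_
    have := h.cov k k i i
    rw [if_pos rfl] at this
    simpa only [sq, Matrix.diag_apply] using this
  have hvar : ∀ k, Var[fun ω => m k ⬝ᵥ ξ k ω; μ] ≤ C.trace * ∑ i, m k i ^ 2 := fun k => by
    refine (variance_le_expectation_sq (hL k).aestronglyMeasurable).trans ?_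
    rw [← hsq k, ← integral_mul_const]
    refine integral_mono (hL k).integrable_sq ((integrable_finsetSum _ fun i _ =>
      (h.memLp k i).integrable_sq).mul_const _) fun ω => ?_
    have := Finset.sum_mul_sq_le_sq_mul_sq Finset.univ (m k) (ξ k ω)
    simp only [Pi.pow_apply, dotProduct]
    linarith
  have hsum : MemLp (∑ k ∈ Finset.range T, fun ω => m k ⬝ᵥ ξ k ω) 2 μ :=
    memLp_finsetSum' _ fun k _ => hL k
  have hmeas : ∀ k, Measurable fun x : D → ℝ => m k ⬝ᵥ x := fun k => by fun_prop
  have hV : Var[∑ k ∈ Finset.range T, fun ω => m k ⬝ᵥ ξ k ω; μ] ≤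
      C.trace * ∑ k ∈ Finset.range T, ∑ i, m k i ^ 2 := by
    rw [IndepFun.variance_sum (fun k _ => hL k) fun j _ k _ hjk =>
      (h.indep.comp (fun k x => m k ⬝ᵥ x) hmeas).indepFun hjk, Finset.mul_sum]
    exact Finset.sum_le_sum fun k _ => hvar k
  have hE : ∫ ω, (∑ k ∈ Finset.range T, fun ω => m k ⬝ᵥ ξ k ω) ω ∂μ = 0 := by
    simp only [Finset.sum_apply]
    rw [integral_finsetSum _ fun k _ => (hL k).integrable one_le_two]
    simp [hmean]
  have hcheb := meas_ge_le_variance_div_sq hsum hc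
  rw [hE] at hcheb
  simp only [Finset.sum_apply, sub_zero] at hcheb
  rw [measureReal_def]
  refine (ENNReal.toReal_mono ENNReal.ofReal_ne_top hcheb).trans ?_
  rw [ENNReal.toReal_ofReal (div_nonneg (variance_nonneg _ _) (sq_nonneg _))]
  gcongr

/-- With probability tending to one, the energy of the disturbance is at least `1 - ε` times its
mean. -/
theorem IsIIDNoise.tendsto_disturbance (h : IsIIDNoise μ C ξ) (hC : 0 < C.trace) (m : ℕ → D → ℝ)
    {ε : ℝ} (hε : 0 < ε) :
    Tendsto (fun T : ℕ => μ.real {ω | ∑ k ∈ Finset.range T, ∑ i, (m k i + ξ k ω i) ^ 2 <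
      (1 - ε) * (T * C.trace + ∑ k ∈ Finset.range T, ∑ i, m k i ^ 2)}) atTop (𝓝 0) := by
  set σ := C.trace
  set E : ℕ → ℝ := fun T => ∑ k ∈ Finset.range T, ∑ i, m k i ^ 2 with hEdef
  have hE : ∀ T, 0 ≤ E T := fun T =>
    Finset.sum_nonneg fun k _ => Finset.sum_nonneg fun i _ => sq_nonneg _
  -- The budget `ε` is split in halves: `ε / 2` for the noise energy, and `ε / 4` for the
  -- correlation, which appears with factor two.
  have h1 := h.tendsto_energy (ε := ε / 2 * σ) (by positivity)
  have h2 : Tendsto (fun T : ℕ => 16 / ε ^ 2 / (T : ℝ)) atTop (𝓝 0) :=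
    tendsto_const_div_atTop_nhds_zero_nat _
  have h12 := h1.add h2
  rw [add_zero] at h12
  refine squeeze_zero' (Eventually.of_forall fun T => measureReal_nonneg) ?_ h12
  filter_upwards [eventually_ge_atTop 1] with T hT
  have hTpos : (0 : ℝ) < T := by exact_mod_cast hT
  have hTσ : 0 < T * σ := mul_pos hTpos hC
  have hc : 0 < ε / 4 * (T * σ + E T) := by have := hE T; positivity
  refine (measureReal_mono (h₂ := measure_ne_top _ _) (s₂ := {ω | ε / 2 * σ ≤
      |(∑ k ∈ Finset.range T, ∑ i, ξ k ω i ^ 2) / T - C.trace|} ∪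
      {ω | ε / 4 * (T * σ + E T) ≤ |∑ k ∈ Finset.range T, m k ⬝ᵥ ξ k ω|}) ?_).trans
    ((measureReal_union_le _ _).trans (add_le_add le_rfl
      ((h.measure_correlation_le m T hc).trans ?_)))
  · intro ω hω
    by_contra hcon
    simp only [Set.mem_union, Set.mem_ofPred_eq, not_or, not_le] at hcon hω
    obtain ⟨hA, hX⟩ := hcon
    rw [abs_lt] at hA hX
    have hexp : ∑ k ∈ Finset.range T, ∑ i, (m k i + ξ k ω i) ^ 2 = E T +
        2 * ∑ k ∈ Finset.range T, m k ⬝ᵥ ξ k ω + ∑ k ∈ Finset.range T, ∑ i, ξ k ω i ^ 2 := by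
      simp only [hEdef, dotProduct, Finset.mul_sum, ← Finset.sum_add_distrib]
      refine Finset.sum_congr rfl fun k _ => Finset.sum_congr rfl fun i _ => ?_
      ring
    have hA' : (σ - ε / 2 * σ) * T < ∑ k ∈ Finset.range T, ∑ i, ξ k ω i ^ 2 := by
      rw [← lt_div_iff₀ hTpos]
      linarith [hA.1]
    have hEε : 0 ≤ ε * E T := mul_nonneg hε.le (hE T)
    rw [hexp] at hω
    nlinarith [hX.1]
  · change σ * E T / (ε / 4 * (T * σ + E T)) ^ 2 ≤ 16 / ε ^ 2 / T
    have hs : 0 < T * σ + E T := by linarith [hE T]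
    rw [div_div, div_le_div_iff₀ (by positivity) (by positivity)]
    -- This makes the Chebyshev bound `16 / (ε² T)` uniform in the energy of `m`, so no growth
    -- condition on `m` is needed.
    have : σ * E T * T ≤ (T * σ + E T) ^ 2 := by nlinarith [hE T, mul_nonneg hTσ.le (hE T)]
    nlinarith [mul_le_mul_of_nonneg_left this (sq_nonneg ε)]

/-- Comparison of an output whose mean energy is bounded by that of the disturbance with the
energy of the disturbance itself. -/
theorem IsIIDNoise.liminf_energy_le (h : IsIIDNoise μ C ξ) (hC : 0 < C.trace) (m : ℕ → D → ℝ)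
    {y : ℕ → Ω → ℝ} (hy : ∀ k, Integrable (y k) μ) (hy0 : ∀ k ω, 0 ≤ y k ω)
    {γ₁ γ₂ c₀ l ρ γ : ℝ} {s : ℕ → ℝ} (hs : Tendsto s atTop (𝓝 l))
    (hl : l ≤ γ₂ ^ 2 * C.trace)
    (hbound : ∀ T, ∑ k ∈ Finset.range T, ∫ ω, y k ω ∂μ ≤
      c₀ + ∑ k ∈ Finset.range T, (γ₁ ^ 2 * ∑ i, m k i ^ 2 + s k))
    (hρ : Tendsto (fun T : ℕ => (∑ k ∈ Finset.range T, ∑ i, m k i ^ 2) /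
      (T * C.trace + ∑ k ∈ Finset.range T, ∑ i, m k i ^ 2)) atTop (𝓝 ρ))
    (hγ : 0 < γ) :
    1 - 1 / γ ^ 2 * (ρ * γ₁ ^ 2 + (1 - ρ) * γ₂ ^ 2) ≤
      liminf (fun T : ℕ => μ.real {ω | ∑ k ∈ Finset.range T, y k ω ≤
        γ ^ 2 * ∑ k ∈ Finset.range T, ∑ i, (m k i + ξ k ω i) ^ 2}) atTop := by
  set σ := C.trace
  set E : ℕ → ℝ := fun T => ∑ k ∈ Finset.range T, ∑ i, m k i ^ 2 with hEdef
  have hE : ∀ T, 0 ≤ E T := fun T =>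
    Finset.sum_nonneg fun k _ => Finset.sum_nonneg fun i _ => sq_nonneg _
  set R := ρ * γ₁ ^ 2 + (1 - ρ) * γ₂ ^ 2 with hR
  set good : ℕ → ℝ := fun T => μ.real {ω | ∑ k ∈ Finset.range T, y k ω ≤
        γ ^ 2 * ∑ k ∈ Finset.range T, ∑ i, (m k i + ξ k ω i) ^ 2} with hgood
  -- the normalized mean energy of the output
  set b : ℕ → ℝ := fun T => c₀ / T + (T : ℝ)⁻¹ * ∑ k ∈ Finset.range T, s k
  have hb : Tendsto b atTop (𝓝 l) := by
    simpa using (tendsto_const_div_atTop_nhds_zero_nat c₀).add hs.cesaro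
  -- A bound for the ratio of mean output energy to mean disturbance energy; the last term covers
  -- the deviation of the averaged costs from their limit.
  set v : ℕ → ℝ := fun T => γ₁ ^ 2 * (E T / (T * σ + E T)) +
    γ₂ ^ 2 * (1 - E T / (T * σ + E T)) + |b T - l| / σ
  have hv : Tendsto v atTop (𝓝 R) := by
    have h1 : Tendsto (fun T => |b T - l| / σ) atTop (𝓝 0) := by
      simpa using ((hb.sub_const l).abs).div_const σ
    have h2 := ((hρ.const_mul (γ₁ ^ 2)).add ((hρ.const_sub 1).const_mul (γ₂ ^ 2))).add h1
    have h3 : R = γ₁ ^ 2 * ρ + γ₂ ^ 2 * (1 - ρ) + 0 := by rw [hR]; ring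
    rw [h3]
    exact h2
  have hmean : ∀ T : ℕ, 1 ≤ T →
      ∫ ω, ∑ k ∈ Finset.range T, y k ω ∂μ ≤ v T * (T * σ + E T) := by
    intro T hT
    have hTpos : (0 : ℝ) < T := by exact_mod_cast hT
    have hs' : 0 < T * σ + E T := by have := hE T; positivity
    rw [integral_finsetSum _ fun k _ => hy k]
    refine (hbound T).trans ?_
    have e1 : c₀ + ∑ k ∈ Finset.range T, (γ₁ ^ 2 * ∑ i, m k i ^ 2 + s k) =
        γ₁ ^ 2 * E T + T * b T := by
      simp only [b, hEdef]
      rw [Finset.sum_add_distrib, ← Finset.mul_sum]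
      field_simp
      ring
    have e2 : v T * (T * σ + E T) = γ₁ ^ 2 * E T + γ₂ ^ 2 * (T * σ) +
        |b T - l| * (T * σ + E T) / σ := by
      simp only [v]
      field_simp
      ring
    have e3 : |b T - l| * T ≤ |b T - l| * (T * σ + E T) / σ := by
      rw [le_div_iff₀ hC]
      nlinarith [mul_nonneg (abs_nonneg (b T - l)) (hE T)]
    have e4 : b T ≤ γ₂ ^ 2 * σ + |b T - l| := by linarith [le_abs_self (b T - l)]
    rw [e1, e2]
    nlinarith [mul_le_mul_of_nonneg_left e4 hTpos.le]
  have hlow : ∀ ε : ℝ, 0 < ε → ε < 1 → 1 - R / (γ ^ 2 * (1 - ε)) ≤ liminf good atTop := by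
    intro ε hε hε1
    have h1ε : 0 < 1 - ε := by linarith
    have hγε : 0 < γ ^ 2 * (1 - ε) := by positivity
    have hp := h.tendsto_disturbance hC m hε
    have hlim := (hp.const_sub 1).sub (hv.div_const (γ ^ 2 * (1 - ε)))
    rw [sub_zero] at hlim
    rw [← hlim.liminf_eq]
    refine liminf_le_liminf ?_ hlim.isBoundedUnder_ge ?_
    · filter_upwards [eventually_ge_atTop 1] with T hT
      have hTpos : (0 : ℝ) < T := by exact_mod_cast hT
      have hs' : 0 < T * σ + E T := by have := hE T; positivity
      have hmk := mul_meas_ge_le_integral_of_nonneg (μ := μ)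
        (f := fun ω => ∑ k ∈ Finset.range T, y k ω)
        (ae_of_all _ fun ω => Finset.sum_nonneg fun k _ => hy0 k ω)
        (integrable_finsetSum _ fun k _ => hy k) (γ ^ 2 * ((1 - ε) * (T * σ + E T)))
      have hq : μ.real {ω | γ ^ 2 * ((1 - ε) * (T * σ + E T)) ≤ ∑ k ∈ Finset.range T, y k ω} ≤
          v T / (γ ^ 2 * (1 - ε)) := by
        rw [le_div_iff₀ hγε]
        refine le_of_mul_le_mul_right ?_ hs'
        refine le_trans (le_of_eq ?_) (hmk.trans (hmean T hT))
        ring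
      -- The gain bound can fail only if the disturbance energy is unusually small or the output
      -- energy exceeds the Markov threshold.
      have hcover : (Set.univ : Set Ω) ⊆ ({ω | ∑ k ∈ Finset.range T, y k ω ≤
          γ ^ 2 * ∑ k ∈ Finset.range T, ∑ i, (m k i + ξ k ω i) ^ 2} ∪
          {ω | ∑ k ∈ Finset.range T, ∑ i, (m k i + ξ k ω i) ^ 2 <
            (1 - ε) * (T * σ + E T)}) ∪
          {ω | γ ^ 2 * ((1 - ε) * (T * σ + E T)) ≤ ∑ k ∈ Finset.range T, y k ω} := by
        intro ω _
        by_contra hcon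
        simp only [Set.mem_union, Set.mem_ofPred_eq, not_or, not_le, not_lt] at hcon
        obtain ⟨⟨hc1, hc2⟩, hc3⟩ := hcon
        have := mul_le_mul_of_nonneg_left hc2 (sq_nonneg γ)
        linarith
      have htot := (measureReal_mono hcover (measure_ne_top μ _)).trans
        ((measureReal_union_le _ _).trans (add_le_add (measureReal_union_le _ _) le_rfl))
      rw [probReal_univ] at htot
      simp only [hgood]
      linarith
    · exact IsBoundedUnder.isCoboundedUnder_ge ⟨1, eventually_map.2 (Eventually.of_forall fun T =>
        measureReal_le_one)⟩
  have hcont : Tendsto (fun ε : ℝ => 1 - R / (γ ^ 2 * (1 - ε))) (𝓝[>] 0)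
      (𝓝 (1 - R / (γ ^ 2 * (1 - 0)))) := by
    refine Tendsto.mono_left (ContinuousAt.tendsto (f := fun ε : ℝ => 1 - R / (γ ^ 2 * (1 - ε))) ?_)
      nhdsWithin_le_nhds
    have : γ ^ 2 * (1 - 0) ≠ 0 := by positivity
    fun_prop (disch := assumption)
  have hfin := le_of_tendsto hcont (by
    filter_upwards [Ioo_mem_nhdsGT (show (0 : ℝ) < 1 by norm_num)] with ε hε
    exact hlow ε hε.1 hε.2)
  rw [sub_zero, mul_one] at hfin
  rwa [one_div_mul_eq_div]

end Disturbance

/-! ### From energies to the truncated gain; the main theorem -/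

theorem sum_Icc_one_eq_sum_range (f : ℕ → ℝ) (T : ℕ) :
    ∑ k ∈ Finset.Icc 1 T, f k = ∑ k ∈ Finset.range T, f (k + 1) := by
  induction T with
  | zero => simp
  | succ T ih => rw [Finset.sum_Icc_succ_top (by omega), ih, Finset.sum_range_succ]

/-- No positivity of the disturbance energy is required: if it vanishes, the hypothesis forces zero
output, and `0 / 0 = 0` in `ENNReal`. -/
theorem truncGain_le {Y U D : Type*} [Fintype Y] [Fintype D] {L : ℕ} {w : ℕ → Y ⊕ U ⊕ D → ℝ}
    {T : ℕ} {γ : ℝ} (hγ : 0 ≤ γ)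
    (h : ∑ k ∈ Finset.range T, ∑ i, w (L + (k + 1)) (Sum.inl i) ^ 2 ≤
      γ ^ 2 * ∑ k ∈ Finset.range T, ∑ i, w (L + (k + 1)) (Sum.inr (Sum.inr i)) ^ 2) :
    truncGain L w T ≤ ENNReal.ofReal γ := by
  rw [truncGain, sum_Icc_one_eq_sum_range, sum_Icc_one_eq_sum_range]
  refine ENNReal.div_le_of_le_mul ?_
  rw [← ENNReal.ofReal_mul hγ]
  refine ENNReal.ofReal_le_ofReal ((Real.sqrt_le_sqrt h).trans ?_)
  rw [Real.sqrt_mul (sq_nonneg γ), Real.sqrt_sq hγ]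

theorem meanEnergy_div {D : Type*} [Fintype D] (m : ℕ → D → ℝ) (σ : ℝ) {T : ℕ} (hT : 1 ≤ T) :
    meanEnergy m T / (σ + meanEnergy m T) =
      (∑ k ∈ Finset.range T, ∑ i, m (k + 1) i ^ 2) /
        (T * σ + ∑ k ∈ Finset.range T, ∑ i, m (k + 1) i ^ 2) := by
  have hTpos : (T : ℝ) ≠ 0 := by positivity
  rw [meanEnergy, sum_Icc_one_eq_sum_range, ← mul_div_mul_left _ _ hTpos]
  congr 1
  · field_simp
  · field_simp

theorem theorem1
    {L : ℕ} {Y U D G : Type*}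
    [Fintype Y] [Fintype U] [Fintype D] [Fintype G]
    [DecidableEq Y] [DecidableEq U] [DecidableEq D] [DecidableEq G] [Nonempty D]
    -- the plant: a controllable LTI behavior with input `(u, d)` and output `y`, lag at most `L`
    (B : Set (ℕ → Y ⊕ U ⊕ D → ℝ))
    (hLTI : IsLTI B) (hlag : lag B ≤ L) (hctrl : IsControllable B) (hio : IsInputOutput B)
    -- the parameterization `F` (full column rank, image the `(L+1)`-step behavior) and `F_z`
    (S : DesignData L Y U D G)
    (hFinj : Function.Injective S.F.mulVec) (hFrange : Set.range S.F.mulVec = windows B L)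
    (hFz : S.FzAdmissible)
    (hSd : S.Sd.PosDef) (hSu : S.Su.PosDef) (hSn : S.Sn.PosDef)
    -- the steady-state covariance and the design
    (P : Matrix G G ℝ) (hP : S.SolvesARE P)
    (γ₁ γ₂ : ℝ) (hγ₁ : 0 ≤ γ₁) (hγ₂ : 0 ≤ γ₂)
    (W X : Matrix G G ℝ) (Yg : Matrix U G ℝ) (Kd : Matrix U D ℝ)
    (hLMI : S.LMIs P γ₁ γ₂ W X Yg Kd)
    -- the uncertainties and the initial data
    {Ω : Type*} [MeasurableSpace Ω] (μ : Measure Ω) [IsProbabilityMeasure μ]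
    (m : ℕ → D → ℝ)
    (Δd : ℕ → Ω → D → ℝ) (Δu : ℕ → Ω → U → ℝ) (n : ℕ → Ω → Y ⊕ U ⊕ D → ℝ)
    (hnoise : NoiseModel μ S Δd Δu n)
    (P₀ : Matrix G G ℝ) (g₀ ghat₀ : Ω → G → ℝ)
    (hinit : InitialModel μ P₀ Δd Δu n g₀ ghat₀) :
    (∃ (w : ℕ → Ω → Y ⊕ U ⊕ D → ℝ) (gprior gpost : ℕ → Ω → G → ℝ),
      S.IsClosedLoop B P₀ W Yg Kd m Δd Δu n g₀ ghat₀ w gprior gpost) ∧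
    ∀ (w : ℕ → Ω → Y ⊕ U ⊕ D → ℝ) (gprior gpost : ℕ → Ω → G → ℝ),
      S.IsClosedLoop B P₀ W Yg Kd m Δd Δu n g₀ ghat₀ w gprior gpost →
      ∀ ρ : ℝ,
        Tendsto (fun T : ℕ => meanEnergy m T / (S.Sd.trace + meanEnergy m T)) atTop (𝓝 ρ) →
      ∀ γ : ℝ, 0 < γ → Real.sqrt (ρ * γ₁ ^ 2 + (1 - ρ) * γ₂ ^ 2) ≤ γ →
        μ {_ω | 1 - 1 / γ ^ 2 * (ρ * γ₁ ^ 2 + (1 - ρ) * γ₂ ^ 2) ≤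
          liminf (fun T : ℕ =>
            μ.real {ω | truncGain L (fun t => w t ω) T ≤ ENNReal.ofReal γ}) atTop} = 1 := by
  have hB : S.Parameterizes B := ⟨hFinj, hFrange, hFz, hio, hLTI.isFiniteMemory hlag⟩
  have hS : S.NoisePos := ⟨hSd, hSu, hSn⟩
  refine ⟨hB.exists_closedLoop P₀ W Yg Kd m Δd Δu n g₀ ghat₀, ?_⟩
  intro w gprior gpost hcl ρ hρ γ hγ _
  have htr : 0 < S.Sd.trace := hSd.trace_pos
  -- Positive semidefiniteness is inherited from being the covariance of the initial error.
  have hP₀ : P₀.PosSemidef :=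
    (hinit.filterState hnoise).cov_e ▸ secondMoment_self_posSemidef (hinit.filterState hnoise).sq_e
  obtain ⟨hint, c₀, hbound⟩ := hcl.energy_le hB hS hLMI hnoise hinit
  have key := hnoise.dist.liminf_energy_le htr (fun k => m (k + 1))
    (y := fun k ω => ∑ i, w (L + (k + 1)) ω (Sum.inl i) ^ 2) (fun k => hint (k + 1))
    (fun k ω => Finset.sum_nonneg fun i _ => sq_nonneg _)
    (hS.tendsto_noiseCost (hB.null_controllable hctrl) hP hP₀)
    (hLMI.trace_le hS hP.1) hbound
    (hρ.congr' (by
      filter_upwards [eventually_ge_atTop 1] with T hT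
      exact meanEnergy_div m _ hT)) hγ
  have hle : 1 - 1 / γ ^ 2 * (ρ * γ₁ ^ 2 + (1 - ρ) * γ₂ ^ 2) ≤
      liminf (fun T : ℕ =>
        μ.real {ω | truncGain L (fun t => w t ω) T ≤ ENNReal.ofReal γ}) atTop := by
    refine key.trans (liminf_le_liminf (Eventually.of_forall fun T => ?_)
      ⟨0, eventually_map.2 (Eventually.of_forall fun T => measureReal_nonneg)⟩
      (IsBoundedUnder.isCoboundedUnder_ge ⟨1, eventually_map.2 (Eventually.of_forall fun T =>
        measureReal_le_one)⟩))
    refine measureReal_mono (fun ω hω => truncGain_le hγ.le ?_) (measure_ne_top _ _)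
    simpa only [hcl.disturbance, Set.mem_ofPred_eq] using hω
  -- The outer event does not depend on the sample point, so it is the whole space.
  simp only [hle, Set.ofPred_true, measure_univ]
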